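/- Let $Q$ be a real symmetric positive-definite $N\times N$ matrix and let $B$ be a real $N\times N$ matrix all of whose (complex) eigenvalues have negative real part. For $t\in(0,\infty]$ put $Q_t=\int_0^t e^{sB}Qe^{sB^*}\,ds$ and let $\gamma_t$ be the centred Gaussian probability measure on $\mathbb{R}^N$ with covariance matrix $Q_t$, i.e. $d\gamma_t(x)=(2\pi)^{-N/2}(\det Q_t)^{-1/2}e^{-\frac12\langle Q_t^{-1}x,x\rangle}\,dx$. Let $\mathcal L$ be the Ornstein–Uhlenbeck operator, that is, the infinitesimal generator in the complex space $L^2(\gamma_\infty)$ of the semigroup $$\mathcal H_tf(x)=\int f(e^{tB}x-y)\,d\gamma_t(y),\qquad t>0;$$ thus $\mathcal L f=\frac12\operatorname{tr}(Q\nabla^2 f)+\langle Bx,\nabla f\rangle$ for Schwartz functions $f$. A generalized eigenfunction of $\mathcal L$ with eigenvalue $\mu\in\mathbb{C}$ is a nonzero $u\in L^2(\gamma_\infty)$ such that, for some integer $k\ge1$, $u$ lies in the domain of $(\mathcal L-\mu)^k$ and $(\mathcal L-\mu)^ku=0$. If the drift matrix $B$ has only one eigenvalue, then any two generalized eigenfunctions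 of $\mathcal L$ with different eigenvalues are orthogonal in $L^2(\gamma_\infty)$. -/

import Mathlib

open MeasureTheory Filter Topology

noncomputable section

namespace OrnsteinUhlenbeck

variable {N : ℕ}

/-- `z` is a (possibly non-real) eigenvalue of the real matrix `B`, regarded as a complex matrix. -/
def IsEigenvalue (B : Matrix (Fin N) (Fin N) ℝ) (z : ℂ) : Prop :=
  Module.End.HasEigenvalue (Matrix.toLin' (B.map Complex.ofReal)) z

/-- The covariance matrix `Q_t = ∫₀ᵗ e^{sB} Q e^{sB*} ds` for `0 < t < ∞` (entrywise integral). -/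
def cov (Q B : Matrix (Fin N) (Fin N) ℝ) (t : ℝ) : Matrix (Fin N) (Fin N) ℝ :=
  Matrix.of fun i j => ∫ s in Set.Ioc 0 t,
    (NormedSpace.exp (s • B) * Q * NormedSpace.exp (s • B.transpose)) i j

/-- The covariance matrix `Q_∞ = ∫₀^∞ e^{sB} Q e^{sB*} ds` (entrywise integral). -/
def covInf (Q B : Matrix (Fin N) (Fin N) ℝ) : Matrix (Fin N) (Fin N) ℝ :=
  Matrix.of fun i j => ∫ s in Set.Ioi (0 : ℝ),
    (NormedSpace.exp (s • B) * Q * NormedSpace.exp (s • B.transpose)) i j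

/-- The centred Gaussian measure on `ℝ^N` with density
`(2π)^{-N/2} (det S)^{-1/2} exp (-½ ⟨S⁻¹ x, x⟩)` with respect to Lebesgue measure. -/
def gaussian (S : Matrix (Fin N) (Fin N) ℝ) : Measure (Fin N → ℝ) :=
  volume.withDensity fun x => ENNReal.ofReal
    ((2 * Real.pi) ^ (-(N : ℝ) / 2) * S.det ^ (-(1 : ℝ) / 2) *
      Real.exp (-(1 / 2) * (S⁻¹.mulVec x ⬝ᵥ x)))

/-- The measure `γ_∞`, which is invariant under the semigroup. -/
def gammaInf (Q B : Matrix (Fin N) (Fin N) ℝ) : Measure (Fin N → ℝ) :=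
  gaussian (covInf Q B)

/-- Kolmogorov's formula `H_t f (x) = ∫ f (e^{tB} x - y) dγ_t(y)` for the
Ornstein-Uhlenbeck semigroup, `t > 0`. -/
def semigroup (Q B : Matrix (Fin N) (Fin N) ℝ) (t : ℝ) (f : (Fin N → ℝ) → ℂ)
    (x : Fin N → ℝ) : ℂ :=
  ∫ y, f ((NormedSpace.exp (t • B)).mulVec x - y) ∂(gaussian (cov Q B t))

/-- The graph of the Ornstein-Uhlenbeck operator `L`, the infinitesimal generator of the semigroup
in the complex space `L²(γ_∞)`: `u` lies in the domain of `L` and `L u = v`, that is,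
`(H_t u - u) / t → v` in `L²(γ_∞)` as `t → 0+`.  The value `H_t u (x)` does not depend on
the representative of the class `u`, since `γ_t` and `γ_∞` have the same null sets as
Lebesgue measure. -/
def IsGenerator (Q B : Matrix (Fin N) (Fin N) ℝ) (u v : Lp ℂ 2 (gammaInf Q B)) : Prop :=
  Tendsto
    (fun t : ℝ => eLpNorm (fun x => (t : ℂ)⁻¹ * (semigroup Q B t u x - u x) - v x) 2
      (gammaInf Q B))
    (𝓝[>] 0) (𝓝 0)

/-- The generator is single-valued: `v = L u` is determined by `u`. -/
theorem IsGenerator.unique {Q B : Matrix (Fin N) (Fin N) ℝ} {u v w : Lp ℂ 2 (gammaInf Q B)}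
    (h1 : IsGenerator Q B u v) (h2 : IsGenerator Q B u w) : v = w := by
  have hs : ∀ t, StronglyMeasurable (semigroup Q B t u) := by
    intro t
    unfold semigroup
    have : SFinite (gaussian (cov Q B t)) := by unfold gaussian; infer_instance
    apply StronglyMeasurable.integral_prod_right' (f := fun p : (Fin N → ℝ) × (Fin N → ℝ) =>
      u ((NormedSpace.exp (t • B)).mulVec p.1 - p.2))
    apply (Lp.stronglyMeasurable u).comp_measurable
    have hc : Continuous fun p : (Fin N → ℝ) × (Fin N → ℝ) =>
        (NormedSpace.exp (t • B)).mulVec p.1 - p.2 := by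
      fun_prop
    exact hc.measurable
  have h3 := h2.add h1
  have key : ∀ t : ℝ, eLpNorm (⇑v - ⇑w) 2 (gammaInf Q B) ≤
      eLpNorm (fun x => (t : ℂ)⁻¹ * (semigroup Q B t u x - u x) - w x) 2 (gammaInf Q B) +
      eLpNorm (fun x => (t : ℂ)⁻¹ * (semigroup Q B t u x - u x) - v x) 2 (gammaInf Q B) := by
    intro t
    have hm : ∀ v : Lp ℂ 2 (gammaInf Q B), AEStronglyMeasurable
        (fun x => (t : ℂ)⁻¹ * (semigroup Q B t u x - u x) - v x) (gammaInf Q B) := fun v =>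
      ((((hs t).sub (Lp.stronglyMeasurable u)).const_mul _).sub
        (Lp.stronglyMeasurable v)).aestronglyMeasurable
    refine le_trans (le_of_eq ?_) (eLpNorm_sub_le (hm w) (hm v) (by norm_num))
    congr 1; ext x; simp
  have h0 : eLpNorm (⇑v - ⇑w) 2 (gammaInf Q B) ≤ 0 := by
    simpa using ge_of_tendsto' h3 key
  have h4 := le_antisymm h0 bot_le
  rw [eLpNorm_eq_zero_iff ((Lp.stronglyMeasurable v).sub
    (Lp.stronglyMeasurable w)).aestronglyMeasurable (by norm_num)] at h4
  apply Lp.ext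
  filter_upwards [h4] with x hx
  simpa [sub_eq_zero] using hx

/-- `u` lies in the domain of `(L - μ)^k` and `(L - μ)^k u = 0`. -/
def IsKilledByPow (Q B : Matrix (Fin N) (Fin N) ℝ) (μ : ℂ) :
    ℕ → Lp ℂ 2 (gammaInf Q B) → Prop
  | 0, u => u = 0
  | k + 1, u => ∃ v, IsGenerator Q B u v ∧ IsKilledByPow Q B μ k (v - μ • u)

/-- `u` is a generalized eigenfunction of `L` with eigenvalue `μ`. -/
def IsGeneralizedEigenfunction (Q B : Matrix (Fin N) (Fin N) ℝ) (μ : ℂ)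
    (u : Lp ℂ 2 (gammaInf Q B)) : Prop :=
  u ≠ 0 ∧ ∃ k : ℕ, 0 < k ∧ IsKilledByPow Q B μ k u

end OrnsteinUhlenbeck

end

/-! Write `S` for `covInf Q B`. A real matrix with a single complex eigenvalue has a real one, `l <
0`, and `B - l` is nilpotent. The claim is that every generalized eigenfunction then lies in a
single Wiener chaos (the span of the Hermite polynomials of one degree `n` for `γ_∞`), with
eigenvalue `n * l`. Different eigenvalues give different degrees, and different chaoses are
orthogonal.

Chaoses are handled through the transform `h ↦ ∫ u(x + S h) dγ_∞(x)`. By Cameron–Martin it is a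
normalized Laplace transform of `u`, hence injective (`ae_eq_of_shiftTransform_eq`). Its part
homogeneous of degree `n` in `h`, `hermiteCoeff`, records the `n`-th chaos component of `u`.
Stationarity, `S = Q_t + e^{tB} S e^{tB*}`, turns the semigroup into the substitution `h ↦ S⁻¹
e^{tB} S h` (`shiftTransform_transfer`), which is linear and so preserves degrees.

Since `e^{tB}` is `e^{lt}` times a polynomial in `t`, the degree-`n` coefficient along this flow is
`e^{nlt} R(t)` with `R` a polynomial. If `(L - μ)^k u = 0`, induction on `k` reduces to the equation
`R' + (n l - μ) R = 0`, which forces `R = 0` unless `n l = μ`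
(`hermiteCoeff_eq_zero_of_isKilledByPow`). As `l ≠ 0`, only one degree survives. With several
eigenvalues of `B`, one degree would carry several exponential rates and this argument would break
down.

Orthogonality of degrees comes from the Mehler operator, the same averaging with `e^{tB}` replaced
by `1/2`: it is symmetric in `L²(γ_∞)` and multiplies degree `n` by `2^{-n}`. -/

noncomputable section

namespace OrnsteinUhlenbeck

variable {N : ℕ}

/-! ### Uniqueness for two-sided Laplace transforms. -/

section Ext

/-- Finite measures whose moment generating functions are finite and agree in every direction
coincide. -/
theorem measure_ext_of_mgf {E : Type*} [NormedAddCommGroup E] [NormedSpace ℝ E]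
    [MeasurableSpace E] [BorelSpace E] [SecondCountableTopology E] [CompleteSpace E]
    {μ ν : Measure E} [IsFiniteMeasure μ] [IsFiniteMeasure ν]
    (hμ : ∀ l : StrongDual ℝ E, Integrable (fun x => Real.exp (l x)) μ)
    (hμν : ∀ l : StrongDual ℝ E, ∫ x, Real.exp (l x) ∂μ = ∫ x, Real.exp (l x) ∂ν) :
    μ = ν := by
  refine Measure.ext_of_charFunDual (funext fun l => ?_)
  have hmgf : ProbabilityTheory.mgf l μ = ProbabilityTheory.mgf l ν := by
    funext t
    simpa [ProbabilityTheory.mgf] using hμν (t • l)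
  have hzero : μ = 0 ↔ ν = 0 := by
    have h0 := hμν 0
    simp only [zero_apply, Real.exp_zero, integral_const, smul_eq_mul,
      mul_one] at h0
    rw [← Measure.measure_univ_eq_zero, ← Measure.measure_univ_eq_zero,
      ← measureReal_eq_zero_iff, h0, measureReal_eq_zero_iff]
  have hset : ProbabilityTheory.integrableExpSet l μ = Set.univ := by
    refine Set.eq_univ_of_forall fun t => ?_
    simpa [ProbabilityTheory.integrableExpSet] using hμ (t • l)
  -- All real exponentials are integrable, so the complex moment generating function is analytic on
  -- the whole plane and determined by its real values; its value at `I` is the characteristic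
  -- function.
  have hc := ProbabilityTheory.eqOn_complexMGF_of_mgf' hmgf hzero
    (x := Complex.I) (by simp [hset])
  simpa [ProbabilityTheory.complexMGF, charFunDual_apply, mul_comm] using hc

/-- A real function is a.e. zero if its exponential moments all vanish. -/
theorem ae_eq_zero_of_integral_mul_exp_real {E : Type*} [NormedAddCommGroup E] [NormedSpace ℝ E]
    [MeasurableSpace E] [BorelSpace E] [SecondCountableTopology E] [CompleteSpace E]
    {μ : Measure E} [IsFiniteMeasure μ] {f : E → ℝ}
    (hf : ∀ l : StrongDual ℝ E, Integrable (fun x => f x * Real.exp (l x)) μ)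
    (hf0 : ∀ l : StrongDual ℝ E, ∫ x, f x * Real.exp (l x) ∂μ = 0) :
    f =ᵐ[μ] 0 := by
  have hfi : Integrable f μ := by simpa using hf 0
  have hm : ∀ g : E → ℝ, Integrable g μ → AEMeasurable (fun x => (g x).toNNReal) μ := fun g hg =>
    hg.1.aemeasurable.real_toNNReal
  have hfin : ∀ g : E → ℝ, Integrable g μ →
      IsFiniteMeasure (μ.withDensity fun x => ((g x).toNNReal : ENNReal)) := fun g hg =>
    isFiniteMeasure_withDensity_ofReal hg.2
  have hexp : ∀ (g : E → ℝ) (l : StrongDual ℝ E), Integrable (fun x => g x * Real.exp (l x)) μ →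
      Integrable (fun x => (g x).toNNReal • Real.exp (l x)) μ := by
    intro g l hg
    refine hg.pos_part.congr (ae_of_all _ fun x => ?_)
    simp only [NNReal.smul_def, Real.coe_toNNReal', smul_eq_mul]
    rw [max_mul_of_nonneg _ _ (Real.exp_pos _).le, zero_mul]
  have hneg : ∀ l : StrongDual ℝ E, Integrable (fun x => (-f) x * Real.exp (l x)) μ := fun l => by
    simpa using (hf l).neg
  have := hfin f hfi
  have := hfin (-f) hfi.neg
  -- The positive and negative parts of `f`, taken as densities, have equal exponential moments, so
  -- they define the same measure.
  have hkey : (μ.withDensity fun x => ((f x).toNNReal : ENNReal)) =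
      μ.withDensity fun x => (((-f) x).toNNReal : ENNReal) := by
    refine measure_ext_of_mgf (fun l => ?_) (fun l => ?_)
    · rw [integrable_withDensity_iff_integrable_smul₀ (hm f hfi)]
      exact hexp f l (hf l)
    · rw [integral_withDensity_eq_integral_smul₀ (hm f hfi),
        integral_withDensity_eq_integral_smul₀ (hm _ hfi.neg), ← sub_eq_zero,
        ← integral_sub (hexp f l (hf l)) (hexp (-f) l (hneg l)), ← hf0 l]
      refine integral_congr_ae (ae_of_all _ fun x => ?_)
      simp only [NNReal.smul_def, Real.coe_toNNReal', smul_eq_mul, Pi.neg_apply]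
      rw [← sub_mul]
      congr 1
      rcases le_total (f x) 0 with h | h
      · simp [h]
      · simp [h]
  have h2 := (withDensity_eq_iff (hm f hfi).coe_nnreal_ennreal
    (hm _ hfi.neg).coe_nnreal_ennreal hfi.lintegral_lt_top.ne).1 hkey
  filter_upwards [h2] with x hx
  have hx' : (f x).toNNReal = ((-f) x).toNNReal := by exact_mod_cast hx
  have hx2 := congrArg NNReal.toReal hx'
  simp only [Real.coe_toNNReal', Pi.neg_apply] at hx2
  rcases le_total (f x) 0 with h | h
  · simp only [h, max_eq_right, Left.nonneg_neg_iff, max_eq_left] at hx2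
    simp only [Pi.zero_apply]; linarith
  · simp only [h, max_eq_left, Left.neg_nonpos_iff, max_eq_right] at hx2
    simpa using hx2

theorem ae_eq_zero_of_integral_mul_exp {E : Type*} [NormedAddCommGroup E] [NormedSpace ℝ E]
    [MeasurableSpace E] [BorelSpace E] [SecondCountableTopology E] [CompleteSpace E]
    {μ : Measure E} [IsFiniteMeasure μ] {f : E → ℂ}
    (hf : ∀ l : StrongDual ℝ E, Integrable (fun x => f x * (Real.exp (l x) : ℂ)) μ)
    (hf0 : ∀ l : StrongDual ℝ E, ∫ x, f x * (Real.exp (l x) : ℂ) ∂μ = 0) :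
    f =ᵐ[μ] 0 := by
  have hre := ae_eq_zero_of_integral_mul_exp_real (μ := μ) (f := fun x => (f x).re)
    (fun l => by simpa [-Complex.ofReal_exp] using (hf l).re) (fun l => by
      have h := integral_re (hf l)
      rw [hf0 l] at h
      simpa [-Complex.ofReal_exp] using h)
  have him := ae_eq_zero_of_integral_mul_exp_real (μ := μ) (f := fun x => (f x).im)
    (fun l => by simpa [-Complex.ofReal_exp] using (hf l).im) (fun l => by
      have h := integral_im (hf l)
      rw [hf0 l] at h
      simpa [-Complex.ofReal_exp] using h)
  filter_upwards [hre, him] with x h1 h2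
  exact Complex.ext h1 h2

end Ext

/-! ### Exponential moments of centred Gaussian measures. -/

section Gaussian

open Matrix

open scoped MatrixOrder in
theorem exists_symm_sqrt {S : Matrix (Fin N) (Fin N) ℝ} (hS : S.PosDef) :
    ∃ A : Matrix (Fin N) (Fin N) ℝ, A.transpose = A ∧ A * A = S := by
  refine ⟨CFC.sqrt S, ?_, CFC.sqrt_mul_sqrt_self S (nonneg_iff_posSemidef.2 hS.posSemidef)⟩
  have h := (nonneg_iff_posSemidef.1 (CFC.sqrt_nonneg S)).isHermitian
  rwa [IsHermitian, conjTranspose_eq_transpose_of_trivial] at h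

theorem ofReal_exp_quadratic (k z : Fin N → ℝ) :
    ((Real.exp (-(1 / 2) * (z ⬝ᵥ z) + k ⬝ᵥ z) : ℝ) : ℂ) =
      Complex.exp (-(1 / 2 : ℂ) * ∑ i, (z i : ℂ) ^ 2 + ∑ i, (k i : ℂ) * z i) := by
  simp only [dotProduct]
  push_cast
  simp only [sq]

theorem integrable_exp_quadratic (k : Fin N → ℝ) :
    Integrable fun z : Fin N → ℝ => Real.exp (-(1 / 2) * (z ⬝ᵥ z) + k ⬝ᵥ z) := by
  have h := GaussianFourier.integrable_cexp_neg_mul_sum_add (ι := Fin N) (b := 1 / 2)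
    (by norm_num) (fun i => (k i : ℂ))
  simp only [← ofReal_exp_quadratic] at h
  exact_mod_cast h.re

theorem integral_exp_quadratic (k : Fin N → ℝ) :
    ∫ z : Fin N → ℝ, Real.exp (-(1 / 2) * (z ⬝ᵥ z) + k ⬝ᵥ z) =
      (2 * Real.pi) ^ ((N : ℝ) / 2) * Real.exp (1 / 2 * (k ⬝ᵥ k)) := by
  have h := GaussianFourier.integral_cexp_neg_mul_sum_add (ι := Fin N) (b := 1 / 2)
    (by norm_num) (fun i => (k i : ℂ))
  simp only [← ofReal_exp_quadratic] at h
  rw [integral_complex_ofReal] at h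
  apply Complex.ofReal_injective
  rw [h, Complex.ofReal_mul, Complex.ofReal_cpow (by positivity)]
  simp only [Fintype.card_fin, dotProduct]
  push_cast
  congr 1
  · congr 1; ring
  · congr 1
    simp only [sq]; ring

theorem gaussian_density_comp {S A : Matrix (Fin N) (Fin N) ℝ} (hS : S.PosDef)
    (hA : A.transpose = A) (hAS : A * A = S) (h z : Fin N → ℝ) :
    -(1 / 2) * (S⁻¹.mulVec (A.mulVec z) ⬝ᵥ A.mulVec z) + h ⬝ᵥ A.mulVec z =
      -(1 / 2) * (z ⬝ᵥ z) + A.mulVec h ⬝ᵥ z := by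
  have hdet : IsUnit A.det := by
    have := (Matrix.isUnit_iff_isUnit_det _).1 hS.isUnit
    rw [← hAS, det_mul] at this
    exact isUnit_of_mul_isUnit_left this
  have h1 : S⁻¹.mulVec (A.mulVec z) = A⁻¹.mulVec z := by
    rw [← hAS, Matrix.mul_inv_rev, mulVec_mulVec, Matrix.mul_assoc, nonsing_inv_mul _ hdet,
      Matrix.mul_one]
  have h2 : ∀ v w : Fin N → ℝ, v ⬝ᵥ A.mulVec w = A.mulVec v ⬝ᵥ w := fun v w => by
    rw [dotProduct_mulVec, ← mulVec_transpose, hA]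
  rw [h1, h2, h2, mulVec_mulVec, mul_nonsing_inv _ hdet, one_mulVec]

/-- Substituting `x = A z`, with `A` a symmetric square root of `S`, reduces to the standard
Gaussian with linear term `A h`; the Jacobian is `|det A| = (det S)^{1/2}`. -/
theorem integrable_and_integral_gaussian_density {S : Matrix (Fin N) (Fin N) ℝ} (hS : S.PosDef)
    (h : Fin N → ℝ) :
    (Integrable fun x : Fin N → ℝ => Real.exp (-(1 / 2) * (S⁻¹.mulVec x ⬝ᵥ x) + h ⬝ᵥ x)) ∧
    ∫ x : Fin N → ℝ, Real.exp (-(1 / 2) * (S⁻¹.mulVec x ⬝ᵥ x) + h ⬝ᵥ x) =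
      S.det ^ ((1 : ℝ) / 2) * (2 * Real.pi) ^ ((N : ℝ) / 2) *
        Real.exp (1 / 2 * (h ⬝ᵥ S.mulVec h)) := by
  obtain ⟨A, hA, hAS⟩ := exists_symm_sqrt hS
  have hdS : S.det = A.det ^ 2 := by rw [← hAS, det_mul, sq]
  have hdet : A.det ≠ 0 := by
    intro h0
    have := hS.det_pos
    simp [hdS, h0] at this
  have hmap := Real.map_matrix_volume_pi_eq_smul_volume_pi hdet
  have hc : ENNReal.ofReal |A.det⁻¹| ≠ 0 := by
    simpa using hdet
  have hmeas : Measurable (toLin' A) := (LinearMap.continuous_of_finiteDimensional _).measurable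
  have hemb : AEStronglyMeasurable
      (fun x : Fin N → ℝ => Real.exp (-(1 / 2) * (S⁻¹.mulVec x ⬝ᵥ x) + h ⬝ᵥ x))
      (Measure.map (toLin' A) volume) := by
    apply Continuous.aestronglyMeasurable
    unfold dotProduct
    fun_prop
  have hcomp : ((fun x : Fin N → ℝ => Real.exp (-(1 / 2) * (S⁻¹.mulVec x ⬝ᵥ x) + h ⬝ᵥ x)) ∘
      toLin' A) = fun z => Real.exp (-(1 / 2) * (z ⬝ᵥ z) + A.mulVec h ⬝ᵥ z) := by
    funext z
    simp only [Function.comp_apply, toLin'_apply]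
    rw [gaussian_density_comp hS hA hAS]
  constructor
  · have h1 := (integrable_map_measure hemb hmeas.aemeasurable).2
      (by rw [hcomp]; exact integrable_exp_quadratic _)
    rwa [hmap, integrable_smul_measure hc ENNReal.ofReal_ne_top] at h1
  · have h1 := integral_map hmeas.aemeasurable hemb
    have h2 : ∫ z, Real.exp (-(1 / 2) * (S⁻¹.mulVec (toLin' A z) ⬝ᵥ toLin' A z) +
        h ⬝ᵥ toLin' A z) = (2 * Real.pi) ^ ((N : ℝ) / 2) *
          Real.exp (1 / 2 * (A.mulVec h ⬝ᵥ A.mulVec h)) := by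
      rw [← integral_exp_quadratic, ← hcomp]
      rfl
    rw [h2, hmap, integral_smul_measure, ENNReal.toReal_ofReal (abs_nonneg _), smul_eq_mul,
      abs_inv, inv_mul_eq_iff_eq_mul₀ (abs_ne_zero.2 hdet)] at h1
    rw [h1, hdS, ← Real.sqrt_eq_rpow, Real.sqrt_sq_eq_abs, mul_assoc]
    congr 4
    rw [dotProduct_mulVec, ← mulVec_transpose, hA, mulVec_mulVec, hAS, dotProduct_comm]

theorem gaussian_density_mul_exp (S : Matrix (Fin N) (Fin N) ℝ) (hS : S.PosDef)
    (h x : Fin N → ℝ) :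
    (ENNReal.ofReal ((2 * Real.pi) ^ (-(N : ℝ) / 2) * S.det ^ (-(1 : ℝ) / 2) *
      Real.exp (-(1 / 2) * (S⁻¹.mulVec x ⬝ᵥ x)))).toReal • Real.exp (h ⬝ᵥ x) =
    (2 * Real.pi) ^ (-(N : ℝ) / 2) * S.det ^ (-(1 : ℝ) / 2) *
      Real.exp (-(1 / 2) * (S⁻¹.mulVec x ⬝ᵥ x) + h ⬝ᵥ x) := by
  have := hS.det_pos
  rw [ENNReal.toReal_ofReal (by positivity), smul_eq_mul, Real.exp_add]
  ring

theorem measurable_gaussian_density (S : Matrix (Fin N) (Fin N) ℝ) :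
    Measurable fun x : Fin N → ℝ => ENNReal.ofReal ((2 * Real.pi) ^ (-(N : ℝ) / 2) *
      S.det ^ (-(1 : ℝ) / 2) * Real.exp (-(1 / 2) * (S⁻¹.mulVec x ⬝ᵥ x))) := by
  apply Measurable.ennreal_ofReal
  apply Continuous.measurable
  unfold dotProduct
  fun_prop

theorem integrable_exp_gaussian {S : Matrix (Fin N) (Fin N) ℝ} (hS : S.PosDef)
    (h : Fin N → ℝ) : Integrable (fun x => Real.exp (h ⬝ᵥ x)) (gaussian S) := by
  unfold gaussian
  rw [integrable_withDensity_iff_integrable_smul' (measurable_gaussian_density S)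
    (ae_of_all _ fun x => ENNReal.ofReal_lt_top)]
  simp only [gaussian_density_mul_exp S hS]
  exact (integrable_and_integral_gaussian_density hS h).1.const_mul _

/-- The moment generating function of a centred Gaussian measure. -/
theorem integral_exp_gaussian {S : Matrix (Fin N) (Fin N) ℝ} (hS : S.PosDef)
    (h : Fin N → ℝ) :
    ∫ x, Real.exp (h ⬝ᵥ x) ∂(gaussian S) = Real.exp (1 / 2 * (h ⬝ᵥ S.mulVec h)) := by
  have hd := hS.det_pos
  unfold gaussian
  rw [integral_withDensity_eq_integral_toReal_smul (measurable_gaussian_density S)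
    (ae_of_all _ fun x => ENNReal.ofReal_lt_top)]
  simp only [gaussian_density_mul_exp S hS]
  rw [integral_const_mul, (integrable_and_integral_gaussian_density hS h).2, neg_div, neg_div,
    Real.rpow_neg (by positivity), Real.rpow_neg hd.le]
  have h1 : (2 * Real.pi) ^ ((N : ℝ) / 2) ≠ 0 := by positivity
  have h2 : S.det ^ ((1 : ℝ) / 2) ≠ 0 := by positivity
  field_simp

theorem isProbabilityMeasure_gaussian {S : Matrix (Fin N) (Fin N) ℝ} (hS : S.PosDef) :
    IsProbabilityMeasure (gaussian S) := by
  have h1 := integrable_exp_gaussian hS 0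
  have h2 := integral_exp_gaussian hS 0
  simp only [zero_dotProduct, Real.exp_zero, mul_zero] at h1 h2
  have h3 : IsFiniteMeasure (gaussian S) := by
    rcases integrable_const_iff.1 h1 with h | h
    · norm_num at h
    · exact h
  refine ⟨?_⟩
  simp only [integral_const, smul_eq_mul, mul_one] at h2
  rwa [measureReal_def, ENNReal.toReal_eq_one_iff] at h2

end Gaussian

/-! ### Gaussian identities in law: stationarity, exchangeability, Cameron–Martin. -/

section Transfer

open Matrix

theorem strongDual_pi_apply (l : StrongDual ℝ (Fin N → ℝ)) (x : Fin N → ℝ) :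
    l x = (fun i => l (Pi.single i 1)) ⬝ᵥ x := by
  conv_lhs => rw [← Finset.univ_sum_single x]
  rw [map_sum, dotProduct]
  refine Finset.sum_congr rfl fun i _ => ?_
  have : (Pi.single i (x i) : Fin N → ℝ) = x i • Pi.single i 1 := by
    rw [← Pi.single_smul', smul_eq_mul, mul_one]
  rw [this, map_smul, smul_eq_mul, mul_comm]

theorem measure_ext_of_mgf_pi {μ ν : Measure (Fin N → ℝ)} [IsFiniteMeasure μ] [IsFiniteMeasure ν]
    (hμ : ∀ h : Fin N → ℝ, Integrable (fun x => Real.exp (h ⬝ᵥ x)) μ)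
    (hμν : ∀ h : Fin N → ℝ, ∫ x, Real.exp (h ⬝ᵥ x) ∂μ = ∫ x, Real.exp (h ⬝ᵥ x) ∂ν) : μ = ν :=
  measure_ext_of_mgf
    (fun l => by rw [funext (strongDual_pi_apply l)]; exact hμ _)
    (fun l => by rw [funext (strongDual_pi_apply l)]; exact hμν _)

theorem measure_ext_of_mgf_prod {μ ν : Measure ((Fin N → ℝ) × (Fin N → ℝ))} [IsFiniteMeasure μ]
    [IsFiniteMeasure ν]
    (hμ : ∀ h k : Fin N → ℝ, Integrable (fun x => Real.exp (h ⬝ᵥ x.1 + k ⬝ᵥ x.2)) μ)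
    (hμν : ∀ h k : Fin N → ℝ, ∫ x, Real.exp (h ⬝ᵥ x.1 + k ⬝ᵥ x.2) ∂μ =
      ∫ x, Real.exp (h ⬝ᵥ x.1 + k ⬝ᵥ x.2) ∂ν) : μ = ν := by
  have hl : ∀ (l : StrongDual ℝ ((Fin N → ℝ) × (Fin N → ℝ))) (x : (Fin N → ℝ) × (Fin N → ℝ)),
      l x = (fun i => l (Pi.single i 1, 0)) ⬝ᵥ x.1 + (fun i => l (0, Pi.single i 1)) ⬝ᵥ x.2 := by
    intro l x
    have h1 := strongDual_pi_apply (l.comp (.inl ℝ _ _)) x.1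
    have h2 := strongDual_pi_apply (l.comp (.inr ℝ _ _)) x.2
    simp only [ContinuousLinearMap.comp_apply, ContinuousLinearMap.inl_apply,
      ContinuousLinearMap.inr_apply] at h1 h2
    rw [← h1, ← h2, ← map_add]
    simp
  exact measure_ext_of_mgf (fun l => by rw [funext (hl l)]; exact hμ _ _)
    (fun l => by rw [funext (hl l)]; exact hμν _ _)

theorem integrable_exp_prod_gaussian {S R : Matrix (Fin N) (Fin N) ℝ} (hS : S.PosDef)
    (hR : R.PosDef) (h k : Fin N → ℝ) :
    Integrable (fun p : (Fin N → ℝ) × (Fin N → ℝ) => Real.exp (h ⬝ᵥ p.1 + k ⬝ᵥ p.2))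
      ((gaussian S).prod (gaussian R)) := by
  have := isProbabilityMeasure_gaussian hS
  have := isProbabilityMeasure_gaussian hR
  simp only [Real.exp_add]
  exact (integrable_exp_gaussian hS h).mul_prod (integrable_exp_gaussian hR k)

theorem integral_exp_prod_gaussian {S R : Matrix (Fin N) (Fin N) ℝ} (hS : S.PosDef)
    (hR : R.PosDef) (h k : Fin N → ℝ) :
    ∫ p : (Fin N → ℝ) × (Fin N → ℝ), Real.exp (h ⬝ᵥ p.1 + k ⬝ᵥ p.2)
      ∂((gaussian S).prod (gaussian R)) =
    Real.exp (1 / 2 * (h ⬝ᵥ S.mulVec h) + 1 / 2 * (k ⬝ᵥ R.mulVec k)) := by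
  have := isProbabilityMeasure_gaussian hS
  have := isProbabilityMeasure_gaussian hR
  simp only [Real.exp_add]
  rw [integral_prod_mul (fun x => Real.exp (h ⬝ᵥ x)) (fun y => Real.exp (k ⬝ᵥ y)),
    integral_exp_gaussian hS, integral_exp_gaussian hR]

theorem dotProduct_mulVec_transpose (A : Matrix (Fin N) (Fin N) ℝ) (v w : Fin N → ℝ) :
    v ⬝ᵥ A.mulVec w = A.transpose.mulVec v ⬝ᵥ w := by
  rw [dotProduct_mulVec, mulVec_transpose]

theorem dotProduct_mulVec_comm {S : Matrix (Fin N) (Fin N) ℝ} (hS : S.PosDef)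
    (v w : Fin N → ℝ) : v ⬝ᵥ S.mulVec w = w ⬝ᵥ S.mulVec v := by
  have h : S.transpose = S := by
    have := hS.isHermitian
    rwa [IsHermitian, conjTranspose_eq_transpose_of_trivial] at this
  rw [dotProduct_mulVec_transpose, h, dotProduct_comm]

/-- If `X ∼ N(0, S)` and `Y ∼ N(0, R)` are independent and `S = R + A S Aᵀ`, then
`A X - Y ∼ N(0, S)`. -/
theorem measurePreserving_mulVec_sub {S R A : Matrix (Fin N) (Fin N) ℝ} (hS : S.PosDef)
    (hR : R.PosDef) (hSR : S = R + A * S * A.transpose) :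
    MeasurePreserving (fun p : (Fin N → ℝ) × (Fin N → ℝ) => A.mulVec p.1 - p.2)
      ((gaussian S).prod (gaussian R)) (gaussian S) := by
  have := isProbabilityMeasure_gaussian hS
  have := isProbabilityMeasure_gaussian hR
  have hm : Measurable (fun p : (Fin N → ℝ) × (Fin N → ℝ) => A.mulVec p.1 - p.2) := by
    apply Continuous.measurable
    fun_prop
  have hexp : ∀ (h : Fin N → ℝ) (p : (Fin N → ℝ) × (Fin N → ℝ)),
      h ⬝ᵥ (A.mulVec p.1 - p.2) = A.transpose.mulVec h ⬝ᵥ p.1 + (-h) ⬝ᵥ p.2 := by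
    intro h p
    rw [dotProduct_sub, dotProduct_mulVec_transpose, neg_dotProduct, sub_eq_add_neg]
  have hsm : ∀ h : Fin N → ℝ, Continuous fun x : Fin N → ℝ => Real.exp (h ⬝ᵥ x) := by
    intro h
    unfold dotProduct
    fun_prop
  refine ⟨hm, ?_⟩
  have : IsFiniteMeasure (Measure.map (fun p : (Fin N → ℝ) × (Fin N → ℝ) => A.mulVec p.1 - p.2)
    ((gaussian S).prod (gaussian R))) := by infer_instance
  refine measure_ext_of_mgf_pi (fun h => ?_) (fun h => ?_)
  · rw [integrable_map_measure (hsm h).aestronglyMeasurable hm.aemeasurable]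
    simp only [Function.comp_def, hexp]
    exact integrable_exp_prod_gaussian hS hR _ _
  · rw [integral_map hm.aemeasurable (hsm h).aestronglyMeasurable]
    simp only [hexp]
    rw [integral_exp_prod_gaussian hS hR, integral_exp_gaussian hS]
    congr 1
    conv_rhs => rw [hSR]
    rw [add_mulVec, dotProduct_add, mulVec_neg, neg_dotProduct, dotProduct_neg, neg_neg,
      ← dotProduct_mulVec_transpose, mulVec_mulVec, mulVec_mulVec]
    ring

/-- If `X ∼ N(0, S)` and `Y ∼ N(0, ¾ S)` are independent then `(X / 2 - Y, X)` is exchangeable. -/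
theorem map_mehler_symm {S : Matrix (Fin N) (Fin N) ℝ} (hS : S.PosDef)
    (hR : ((3 / 4 : ℝ) • S).PosDef) :
    Measure.map (fun p : (Fin N → ℝ) × (Fin N → ℝ) =>
        (((1 / 2 : ℝ) • (1 : Matrix (Fin N) (Fin N) ℝ)).mulVec p.1 - p.2, p.1))
      ((gaussian S).prod (gaussian ((3 / 4 : ℝ) • S))) =
    Measure.map (fun p : (Fin N → ℝ) × (Fin N → ℝ) =>
        (p.1, ((1 / 2 : ℝ) • (1 : Matrix (Fin N) (Fin N) ℝ)).mulVec p.1 - p.2))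
      ((gaussian S).prod (gaussian ((3 / 4 : ℝ) • S))) := by
  have := isProbabilityMeasure_gaussian hS
  have := isProbabilityMeasure_gaussian hR
  have hm1 : Measurable (fun p : (Fin N → ℝ) × (Fin N → ℝ) =>
      (((1 / 2 : ℝ) • (1 : Matrix (Fin N) (Fin N) ℝ)).mulVec p.1 - p.2, p.1)) := by
    apply Continuous.measurable
    fun_prop
  have hm2 : Measurable (fun p : (Fin N → ℝ) × (Fin N → ℝ) =>
      (p.1, ((1 / 2 : ℝ) • (1 : Matrix (Fin N) (Fin N) ℝ)).mulVec p.1 - p.2)) := by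
    apply Continuous.measurable
    fun_prop
  have hsm : ∀ h k : Fin N → ℝ, Continuous fun x : (Fin N → ℝ) × (Fin N → ℝ) =>
      Real.exp (h ⬝ᵥ x.1 + k ⬝ᵥ x.2) := by
    intro h k
    unfold dotProduct
    fun_prop
  have hexp1 : ∀ (h k : Fin N → ℝ) (p : (Fin N → ℝ) × (Fin N → ℝ)),
      h ⬝ᵥ (((1 / 2 : ℝ) • (1 : Matrix (Fin N) (Fin N) ℝ)).mulVec p.1 - p.2) + k ⬝ᵥ p.1 =
        ((1 / 2 : ℝ) • h + k) ⬝ᵥ p.1 + (-h) ⬝ᵥ p.2 := by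
    intro h k p
    rw [dotProduct_sub, smul_mulVec, one_mulVec, dotProduct_smul, add_dotProduct, smul_dotProduct,
      neg_dotProduct]
    ring
  refine measure_ext_of_mgf_prod (fun h k => ?_) (fun h k => ?_)
  · rw [integrable_map_measure (hsm h k).aestronglyMeasurable hm1.aemeasurable]
    simp only [Function.comp_def, hexp1]
    exact integrable_exp_prod_gaussian hS hR _ _
  · rw [integral_map hm1.aemeasurable (hsm h k).aestronglyMeasurable,
      integral_map hm2.aemeasurable (hsm h k).aestronglyMeasurable]
    simp only [hexp1]
    -- The second map is the first with its components swapped, so `hexp1` applies with `h` and `k`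
    -- exchanged. It remains to see that the resulting quadratic form is symmetric in `h` and `k`;
    -- the weights `1/4 + 3/4 = 1` ensure this.
    simp only [add_comm (h ⬝ᵥ _) (k ⬝ᵥ _), hexp1]
    rw [integral_exp_prod_gaussian hS hR, integral_exp_prod_gaussian hS hR]
    congr 1
    simp only [mulVec_add, mulVec_smul, mulVec_neg, smul_mulVec, dotProduct_add, add_dotProduct,
      smul_dotProduct, dotProduct_smul, neg_dotProduct, dotProduct_neg, smul_eq_mul,
      dotProduct_mulVec_comm hS k h]
    ring

/-- Cameron-Martin formula for a centred Gaussian measure. -/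
theorem gaussian_withDensity_exp {S : Matrix (Fin N) (Fin N) ℝ} (hS : S.PosDef)
    (h : Fin N → ℝ) :
    (gaussian S).withDensity
        (fun x => ENNReal.ofReal (Real.exp (h ⬝ᵥ x - 1 / 2 * (h ⬝ᵥ S.mulVec h)))) =
      (gaussian S).map (fun x => x + S.mulVec h) := by
  have := isProbabilityMeasure_gaussian hS
  have hsm : ∀ h : Fin N → ℝ, Continuous fun x : Fin N → ℝ => Real.exp (h ⬝ᵥ x) := by
    intro h
    unfold dotProduct
    fun_prop
  have hdm : Measurable fun x : Fin N → ℝ =>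
      ENNReal.ofReal (Real.exp (h ⬝ᵥ x - 1 / 2 * (h ⬝ᵥ S.mulVec h))) := by
    apply Measurable.ennreal_ofReal
    apply Continuous.measurable
    unfold dotProduct
    fun_prop
  have hlt : ∀ᵐ x ∂(gaussian S),
      ENNReal.ofReal (Real.exp (h ⬝ᵥ x - 1 / 2 * (h ⬝ᵥ S.mulVec h))) < ⊤ :=
    ae_of_all _ fun x => ENNReal.ofReal_lt_top
  have hid : ∀ k x : Fin N → ℝ,
      (ENNReal.ofReal (Real.exp (h ⬝ᵥ x - 1 / 2 * (h ⬝ᵥ S.mulVec h)))).toReal •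
        Real.exp (k ⬝ᵥ x) =
      Real.exp (-(1 / 2 * (h ⬝ᵥ S.mulVec h))) * Real.exp ((h + k) ⬝ᵥ x) := by
    intro k x
    rw [ENNReal.toReal_ofReal (Real.exp_pos _).le, smul_eq_mul, ← Real.exp_add, ← Real.exp_add,
      add_dotProduct]
    congr 1
    ring
  have hint : ∀ k : Fin N → ℝ, Integrable (fun x => Real.exp (k ⬝ᵥ x))
      ((gaussian S).withDensity
        (fun x => ENNReal.ofReal (Real.exp (h ⬝ᵥ x - 1 / 2 * (h ⬝ᵥ S.mulVec h))))) := by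
    intro k
    rw [integrable_withDensity_iff_integrable_smul' hdm hlt]
    simp only [hid]
    exact (integrable_exp_gaussian hS _).const_mul _
  have hfin : IsFiniteMeasure ((gaussian S).withDensity
      (fun x => ENNReal.ofReal (Real.exp (h ⬝ᵥ x - 1 / 2 * (h ⬝ᵥ S.mulVec h))))) := by
    have h0 := hint 0
    simp only [zero_dotProduct, Real.exp_zero] at h0
    rcases integrable_const_iff.1 h0 with h' | h'
    · norm_num at h'
    · exact h'
  have hm : Measurable fun x : Fin N → ℝ => x + S.mulVec h := by fun_prop
  refine measure_ext_of_mgf_pi hint (fun k => ?_)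
  rw [integral_withDensity_eq_integral_toReal_smul hdm hlt,
    integral_map hm.aemeasurable (hsm k).aestronglyMeasurable]
  simp only [hid, dotProduct_add, Real.exp_add]
  rw [integral_const_mul, integral_mul_const, integral_exp_gaussian hS, integral_exp_gaussian hS,
    ← Real.exp_add, ← Real.exp_add]
  congr 1
  simp only [mulVec_add, dotProduct_add, add_dotProduct, dotProduct_mulVec_comm hS h k]
  ring

end Transfer

/-! ### The shift transform and its intertwining with Gaussian averaging. -/

section ShiftTransform

open Matrix

theorem continuous_exp_dotProduct (h : Fin N → ℝ) :
    Continuous fun x : Fin N → ℝ => Real.exp (h ⬝ᵥ x) := by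
  unfold dotProduct
  fun_prop

theorem continuous_dotProduct_pow (h : Fin N → ℝ) (p : ℕ) :
    Continuous fun x : Fin N → ℝ => ((h ⬝ᵥ x) ^ p : ℝ) := by
  unfold dotProduct
  fun_prop

/-- A strongly measurable function that is integrable against every real exponential. -/
def HasExpMoments (μ : Measure (Fin N → ℝ)) (u : (Fin N → ℝ) → ℂ) : Prop :=
  StronglyMeasurable u ∧
    ∀ h : Fin N → ℝ, Integrable (fun x => u x * ((Real.exp (h ⬝ᵥ x) : ℝ) : ℂ)) μ

theorem HasExpMoments.const_mul {μ : Measure (Fin N → ℝ)} {u : (Fin N → ℝ) → ℂ}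
    (hu : HasExpMoments μ u) (c : ℂ) : HasExpMoments μ (fun x => c * u x) :=
  ⟨hu.1.const_mul c, fun h => by simpa only [mul_assoc] using (hu.2 h).const_mul c⟩

theorem HasExpMoments.sub {μ : Measure (Fin N → ℝ)} {u v : (Fin N → ℝ) → ℂ}
    (hu : HasExpMoments μ u) (hv : HasExpMoments μ v) : HasExpMoments μ (fun x => u x - v x) :=
  ⟨hu.1.sub hv.1, fun h => by
    simp only [sub_mul]
    exact (hu.2 h).sub (hv.2 h)⟩

theorem memLp_exp_gaussian {S : Matrix (Fin N) (Fin N) ℝ} (hS : S.PosDef) (h : Fin N → ℝ) :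
    MemLp (fun x => ((Real.exp (h ⬝ᵥ x) : ℝ) : ℂ)) 2 (gaussian S) := by
  refine MemLp.ofReal (f := fun x => Real.exp (h ⬝ᵥ x)) ?_
  rw [memLp_two_iff_integrable_sq (continuous_exp_dotProduct h).aestronglyMeasurable]
  refine (integrable_exp_gaussian hS ((2 : ℝ) • h)).congr (ae_of_all _ fun x => ?_)
  beta_reduce
  rw [smul_dotProduct, smul_eq_mul, ← Real.exp_nat_mul, Nat.cast_ofNat]

theorem hasExpMoments_of_memLp {S : Matrix (Fin N) (Fin N) ℝ} (hS : S.PosDef)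
    {u : (Fin N → ℝ) → ℂ} (hum : StronglyMeasurable u) (hu : MemLp u 2 (gaussian S)) :
    HasExpMoments (gaussian S) u :=
  ⟨hum, fun h => hu.integrable_mul (memLp_exp_gaussian hS h)⟩

theorem HasExpMoments.integrable_norm_mul_exp_abs {μ : Measure (Fin N → ℝ)}
    {u : (Fin N → ℝ) → ℂ} (hu : HasExpMoments μ u) (h : Fin N → ℝ) :
    Integrable (fun x => ‖u x‖ * Real.exp |h ⬝ᵥ x|) μ := by
  have h1 : ∀ k : Fin N → ℝ, Integrable (fun x => ‖u x‖ * Real.exp (k ⬝ᵥ x)) μ := by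
    intro k
    refine (hu.2 k).norm.congr (ae_of_all _ fun x => ?_)
    simp only [norm_mul, Complex.norm_real, Real.norm_eq_abs, Real.abs_exp]
  -- The domination used is `e^{|a|} ≤ e^a + e^{-a}`.
  refine ((h1 h).add (h1 (-h))).mono' ?_ (ae_of_all _ fun x => ?_)
  · refine hu.1.norm.aestronglyMeasurable.mul (Continuous.aestronglyMeasurable ?_)
    unfold dotProduct
    fun_prop
  · rw [Real.norm_of_nonneg (by positivity)]
    simp only [Pi.add_apply, neg_dotProduct, ← mul_add]
    gcongr
    rcases abs_cases (h ⬝ᵥ x) with ⟨h', _⟩ | ⟨h', _⟩ <;> rw [h'] <;>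
      nlinarith [Real.exp_pos (h ⬝ᵥ x), Real.exp_pos (-(h ⬝ᵥ x))]

theorem HasExpMoments.integrable_mul_pow {μ : Measure (Fin N → ℝ)}
    {u : (Fin N → ℝ) → ℂ} (hu : HasExpMoments μ u) (h : Fin N → ℝ) (p : ℕ) :
    Integrable (fun x => u x * (((h ⬝ᵥ x) ^ p : ℝ) : ℂ)) μ := by
  refine ((hu.integrable_norm_mul_exp_abs h).const_mul (p.factorial : ℝ)).mono' ?_
    (ae_of_all _ fun x => ?_)
  · exact hu.1.aestronglyMeasurable.mul
      (Complex.continuous_ofReal.comp (continuous_dotProduct_pow h p)).aestronglyMeasurable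
  · have h1 := Real.pow_div_factorial_le_exp |h ⬝ᵥ x| (abs_nonneg _) p
    rw [div_le_iff₀ (by positivity)] at h1
    rw [norm_mul, Complex.norm_real, Real.norm_eq_abs, abs_pow]
    nlinarith [norm_nonneg (u x)]

/-- The moment `∫ u(x) ⟨h, x⟩ᵖ dμ(x)`. -/
def directionalMoment (μ : Measure (Fin N → ℝ)) (u : (Fin N → ℝ) → ℂ) (h : Fin N → ℝ) (p : ℕ) :
    ℂ :=
  ∫ x, u x * (((h ⬝ᵥ x) ^ p : ℝ) : ℂ) ∂μ

theorem HasExpMoments.hasSum_directionalMoment {μ : Measure (Fin N → ℝ)}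
    {u : (Fin N → ℝ) → ℂ} (hu : HasExpMoments μ u) (h : Fin N → ℝ) (r : ℝ) :
    HasSum (fun p : ℕ => (r : ℂ) ^ p * (directionalMoment μ u h p / p.factorial))
      (∫ x, u x * ((Real.exp ((r • h) ⬝ᵥ x) : ℝ) : ℂ) ∂μ) := by
  have hs : ∀ y : ℝ, HasSum (fun p : ℕ => y ^ p / p.factorial) (Real.exp y) := by
    intro y
    rw [Real.exp_eq_exp_ℝ]
    exact NormedSpace.expSeries_div_hasSum_exp y
  have h1 := hasSum_integral_of_dominated_convergence (μ := μ)
    (F := fun (p : ℕ) x => u x * ((((r • h) ⬝ᵥ x) ^ p / p.factorial : ℝ) : ℂ))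
    (f := fun x => u x * ((Real.exp ((r • h) ⬝ᵥ x) : ℝ) : ℂ))
    (fun (p : ℕ) x => ‖u x‖ * (|(r • h) ⬝ᵥ x| ^ p / p.factorial))
    (fun p => hu.1.aestronglyMeasurable.mul (Complex.continuous_ofReal.comp
      ((continuous_dotProduct_pow (r • h) p).div_const _)).aestronglyMeasurable)
    (fun p => ae_of_all _ fun x => by
      rw [norm_mul, Complex.norm_real, Real.norm_eq_abs, abs_div, abs_pow, Nat.abs_cast])
    (ae_of_all _ fun x => (hs _).summable.mul_left _)
    ?_ (ae_of_all _ fun x => ?_)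
  · refine h1.congr_fun fun p => ?_
    rw [directionalMoment, ← integral_div, ← integral_const_mul]
    refine integral_congr_ae (ae_of_all _ fun x => ?_)
    simp only [smul_dotProduct, smul_eq_mul, mul_pow]
    push_cast
    ring
  · simp only [tsum_mul_left, (hs _).tsum_eq]
    exact hu.integrable_norm_mul_exp_abs _
  · exact ((Complex.hasSum_ofReal.2 (hs _)).mul_left _)

/-- The transform `h ↦ ∫ u(x + S h) dγ_S(x)`. -/
def shiftTransform (S : Matrix (Fin N) (Fin N) ℝ) (u : (Fin N → ℝ) → ℂ) (h : Fin N → ℝ) : ℂ :=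
  ∫ x, u (x + S.mulVec h) ∂(gaussian S)

theorem measurable_cameronMartin (S : Matrix (Fin N) (Fin N) ℝ) (h : Fin N → ℝ) :
    Measurable fun x : Fin N → ℝ =>
      ENNReal.ofReal (Real.exp (h ⬝ᵥ x - 1 / 2 * (h ⬝ᵥ S.mulVec h))) := by
  apply Measurable.ennreal_ofReal
  apply Continuous.measurable
  unfold dotProduct
  fun_prop

theorem cameronMartin_smul (S : Matrix (Fin N) (Fin N) ℝ) (u : (Fin N → ℝ) → ℂ)
    (h x : Fin N → ℝ) :
    (ENNReal.ofReal (Real.exp (h ⬝ᵥ x - 1 / 2 * (h ⬝ᵥ S.mulVec h)))).toReal • u x =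
      ((Real.exp (-(1 / 2 * (h ⬝ᵥ S.mulVec h))) : ℝ) : ℂ) *
        (u x * ((Real.exp (h ⬝ᵥ x) : ℝ) : ℂ)) := by
  rw [ENNReal.toReal_ofReal (Real.exp_pos _).le, sub_eq_add_neg, Real.exp_add,
    Complex.real_smul]
  push_cast
  ring

theorem integrable_shift_iff {S : Matrix (Fin N) (Fin N) ℝ} (hS : S.PosDef)
    {u : (Fin N → ℝ) → ℂ} (hu : StronglyMeasurable u) (h : Fin N → ℝ) :
    Integrable (fun x => u (x + S.mulVec h)) (gaussian S) ↔
      Integrable (fun x => u x * ((Real.exp (h ⬝ᵥ x) : ℝ) : ℂ)) (gaussian S) := by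
  have hm : Measurable fun x : Fin N → ℝ => x + S.mulVec h := by fun_prop
  have h1 := integrable_map_measure (μ := gaussian S) (g := u) hu.aestronglyMeasurable
    hm.aemeasurable
  rw [Function.comp_def] at h1
  rw [← h1, ← gaussian_withDensity_exp hS, integrable_withDensity_iff_integrable_smul'
    (measurable_cameronMartin S h) (ae_of_all _ fun x => ENNReal.ofReal_lt_top)]
  simp only [cameronMartin_smul]
  have hne : ((Real.exp (-(1 / 2 * (h ⬝ᵥ S.mulVec h))) : ℝ) : ℂ) ≠ 0 := by
    exact_mod_cast (Real.exp_pos _).ne'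
  exact integrable_const_mul_iff hne.isUnit _

/-- By Cameron–Martin, translating the measure by `S h` is the same as weighting it by a normalized
exponential. -/
theorem shiftTransform_eq {S : Matrix (Fin N) (Fin N) ℝ} (hS : S.PosDef)
    {u : (Fin N → ℝ) → ℂ} (hu : StronglyMeasurable u) (h : Fin N → ℝ) :
    shiftTransform S u h = ((Real.exp (-(1 / 2 * (h ⬝ᵥ S.mulVec h))) : ℝ) : ℂ) *
      ∫ x, u x * ((Real.exp (h ⬝ᵥ x) : ℝ) : ℂ) ∂(gaussian S) := by
  have hm : Measurable fun x : Fin N → ℝ => x + S.mulVec h := by fun_prop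
  rw [shiftTransform, ← integral_map hm.aemeasurable hu.aestronglyMeasurable,
    ← gaussian_withDensity_exp hS, integral_withDensity_eq_integral_toReal_smul
    (measurable_cameronMartin S h) (ae_of_all _ fun x => ENNReal.ofReal_lt_top)]
  simp only [cameronMartin_smul]
  rw [integral_const_mul]

theorem ae_eq_of_shiftTransform_eq {S : Matrix (Fin N) (Fin N) ℝ} (hS : S.PosDef)
    {u v : (Fin N → ℝ) → ℂ} (hu : HasExpMoments (gaussian S) u)
    (hv : HasExpMoments (gaussian S) v)
    (huv : ∀ h, shiftTransform S u h = shiftTransform S v h) : u =ᵐ[gaussian S] v := by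
  have := isProbabilityMeasure_gaussian hS
  have h1 := ae_eq_zero_of_integral_mul_exp (μ := gaussian S) (f := fun x => u x - v x)
    (fun l => by rw [funext (strongDual_pi_apply l)]; exact (hu.sub hv).2 _) (fun l => by
      rw [funext (strongDual_pi_apply l)]
      set h : Fin N → ℝ := fun i => l (Pi.single i 1)
      have h2 := huv h
      rw [shiftTransform_eq hS hu.1, shiftTransform_eq hS hv.1] at h2
      have h3 := mul_left_cancel₀ (by exact_mod_cast (Real.exp_pos _).ne') h2
      simp only [sub_mul]
      rw [integral_sub (hu.2 h) (hv.2 h), h3, sub_self])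
  filter_upwards [h1] with x hx
  exact sub_eq_zero.1 hx

/-- Averaging of `u` over `A x - y`, where `y` has law `ν`. -/
def transfer (A : Matrix (Fin N) (Fin N) ℝ) (ν : Measure (Fin N → ℝ)) (u : (Fin N → ℝ) → ℂ)
    (x : Fin N → ℝ) : ℂ :=
  ∫ y, u (A.mulVec x - y) ∂ν

theorem stronglyMeasurable_transfer (A : Matrix (Fin N) (Fin N) ℝ) (ν : Measure (Fin N → ℝ))
    [SFinite ν] {u : (Fin N → ℝ) → ℂ} (hu : StronglyMeasurable u) :
    StronglyMeasurable (transfer A ν u) := by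
  apply StronglyMeasurable.integral_prod_right' (f := fun p : (Fin N → ℝ) × (Fin N → ℝ) =>
    u (A.mulVec p.1 - p.2))
  apply hu.comp_measurable
  apply Continuous.measurable
  fun_prop

section Stationary

variable {S R A : Matrix (Fin N) (Fin N) ℝ} {u v : (Fin N → ℝ) → ℂ}

theorem integrable_transfer_shift (hS : S.PosDef) (hR : R.PosDef)
    (hSR : S = R + A * S * A.transpose) (hu : HasExpMoments (gaussian S) u) {h k : Fin N → ℝ}
    (hk : S.mulVec k = A.mulVec (S.mulVec h)) :
    Integrable (fun p : (Fin N → ℝ) × (Fin N → ℝ) => u (A.mulVec (p.1 + S.mulVec h) - p.2))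
      ((gaussian S).prod (gaussian R)) := by
  have h1 := (measurePreserving_mulVec_sub hS hR hSR).integrable_comp_of_integrable
    ((integrable_shift_iff hS hu.1 k).2 (hu.2 k))
  refine h1.congr (ae_of_all _ fun p => ?_)
  simp only [Function.comp_apply, hk, mulVec_add]
  congr 1
  abel

theorem exists_mulVec_eq (hS : S.PosDef) (a : Fin N → ℝ) : ∃ k, S.mulVec k = a :=
  ⟨S⁻¹.mulVec a, by
    rw [mulVec_mulVec, mul_nonsing_inv _ ((Matrix.isUnit_iff_isUnit_det _).1 hS.isUnit),
      one_mulVec]⟩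

theorem hasExpMoments_transfer (hS : S.PosDef) (hR : R.PosDef)
    (hSR : S = R + A * S * A.transpose) (hu : HasExpMoments (gaussian S) u) :
    HasExpMoments (gaussian S) (transfer A (gaussian R) u) := by
  have := isProbabilityMeasure_gaussian hS
  have := isProbabilityMeasure_gaussian hR
  have hm := stronglyMeasurable_transfer A (gaussian R) hu.1
  refine ⟨hm, fun h => ?_⟩
  obtain ⟨k, hk⟩ := exists_mulVec_eq hS (A.mulVec (S.mulVec h))
  rw [← integrable_shift_iff hS hm]
  exact (integrable_transfer_shift hS hR hSR hu hk).integral_prod_left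

/-- Shifting `X` by `S h` shifts `A X - Y` by `A S h = S k`, and `A X - Y` has the same law as `X`.
With `A = e^{tB}` this is the semigroup; with `A = 1/2` it is the Mehler operator. -/
theorem shiftTransform_transfer (hS : S.PosDef) (hR : R.PosDef)
    (hSR : S = R + A * S * A.transpose) (hu : HasExpMoments (gaussian S) u) {h k : Fin N → ℝ}
    (hk : S.mulVec k = A.mulVec (S.mulVec h)) :
    shiftTransform S (transfer A (gaussian R) u) h = shiftTransform S u k := by
  have := isProbabilityMeasure_gaussian hS
  have := isProbabilityMeasure_gaussian hR
  have hmp := measurePreserving_mulVec_sub hS hR hSR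
  unfold shiftTransform transfer
  rw [← integral_prod _ (integrable_transfer_shift hS hR hSR hu hk)]
  conv_rhs => rw [← hmp.map_eq]
  rw [integral_map (f := fun x => u (x + S.mulVec k)) hmp.measurable.aemeasurable
    (hu.1.comp_measurable (by fun_prop)).aestronglyMeasurable]
  refine integral_congr_ae (ae_of_all _ fun p => ?_)
  simp only [hk, mulVec_add]
  congr 1
  abel

theorem integrable_transfer_mul (hS : S.PosDef) (hR : R.PosDef)
    (hSR : S = R + A * S * A.transpose) (hu : MemLp u 2 (gaussian S))
    (hv : MemLp v 2 (gaussian S)) :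
    Integrable (fun p : (Fin N → ℝ) × (Fin N → ℝ) => u (A.mulVec p.1 - p.2) * v p.1)
      ((gaussian S).prod (gaussian R)) := by
  have := isProbabilityMeasure_gaussian hS
  have := isProbabilityMeasure_gaussian hR
  exact (hu.comp_measurePreserving (measurePreserving_mulVec_sub hS hR hSR)).integrable_mul
    (hv.comp_measurePreserving measurePreserving_fst)

/-- The Mehler operator `u ↦ ∫ u(x / 2 - y) dγ_{3S/4}(y)` is symmetric. -/
theorem integral_mehler_mul (hS : S.PosDef) (hR : ((3 / 4 : ℝ) • S).PosDef)
    (hSR : S = (3 / 4 : ℝ) • S + ((1 / 2 : ℝ) • (1 : Matrix (Fin N) (Fin N) ℝ)) * S *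
      ((1 / 2 : ℝ) • (1 : Matrix (Fin N) (Fin N) ℝ)).transpose)
    (hum : StronglyMeasurable u) (hvm : StronglyMeasurable v)
    (hu : MemLp u 2 (gaussian S)) (hv : MemLp v 2 (gaussian S)) :
    ∫ x, transfer ((1 / 2 : ℝ) • 1) (gaussian ((3 / 4 : ℝ) • S)) u x * v x ∂(gaussian S) =
      ∫ x, u x * transfer ((1 / 2 : ℝ) • 1) (gaussian ((3 / 4 : ℝ) • S)) v x ∂(gaussian S) := by
  have := isProbabilityMeasure_gaussian hS
  have := isProbabilityMeasure_gaussian hR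
  have hm1 : Measurable (fun p : (Fin N → ℝ) × (Fin N → ℝ) =>
      (((1 / 2 : ℝ) • (1 : Matrix (Fin N) (Fin N) ℝ)).mulVec p.1 - p.2, p.1)) := by
    apply Continuous.measurable
    fun_prop
  have hm2 : Measurable (fun p : (Fin N → ℝ) × (Fin N → ℝ) =>
      (p.1, ((1 / 2 : ℝ) • (1 : Matrix (Fin N) (Fin N) ℝ)).mulVec p.1 - p.2)) := by
    apply Continuous.measurable
    fun_prop
  have hF : StronglyMeasurable fun p : (Fin N → ℝ) × (Fin N → ℝ) => u p.1 * v p.2 :=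
    (hum.comp_measurable measurable_fst).mul (hvm.comp_measurable measurable_snd)
  have h1 : ∀ w z : (Fin N → ℝ) → ℂ, MemLp w 2 (gaussian S) → MemLp z 2 (gaussian S) →
      ∫ x, transfer ((1 / 2 : ℝ) • 1) (gaussian ((3 / 4 : ℝ) • S)) w x * z x ∂(gaussian S) =
      ∫ p : (Fin N → ℝ) × (Fin N → ℝ),
        w (((1 / 2 : ℝ) • (1 : Matrix (Fin N) (Fin N) ℝ)).mulVec p.1 - p.2) * z p.1
        ∂((gaussian S).prod (gaussian ((3 / 4 : ℝ) • S))) := by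
    intro w z hw hz
    rw [integral_prod _ (integrable_transfer_mul hS hR hSR hw hz)]
    simp only [transfer, integral_mul_const]
  -- Both sides of the claim integrate `u ⊗ v` against a joint law of `X` and `X / 2 - Y`, in the
  -- two possible orders; exchangeability identifies these laws.
  have h2 := congrArg (fun ξ => ∫ p, u p.1 * v p.2 ∂ξ) (map_mehler_symm hS hR)
  simp only [integral_map hm1.aemeasurable hF.aestronglyMeasurable,
    integral_map hm2.aemeasurable hF.aestronglyMeasurable] at h2
  rw [h1 u v hu hv, h2]
  simp only [mul_comm (u _)]
  rw [h1 v u hv hu]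

end Stationary

end ShiftTransform

/-! ### Homogeneous components of the shift transform. -/

section Hermite

open Matrix

/-- The Taylor coefficients at `0` of `r ↦ exp (-r² β / 2)`. -/
def gaussCoeff (β : ℝ) (q : ℕ) : ℂ :=
  if Even q then ((-(β / 2) : ℝ) : ℂ) ^ (q / 2) / (q / 2).factorial else 0

theorem hasSum_gaussCoeff (β r : ℝ) :
    HasSum (fun q : ℕ => (r : ℂ) ^ q * gaussCoeff β q)
      ((Real.exp (-(1 / 2 * (r ^ 2 * β))) : ℝ) : ℂ) := by
  have hinj : Function.Injective fun i : ℕ => 2 * i := fun a b h => by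
    simpa using h
  rw [← hinj.hasSum_iff]
  · have h1 := NormedSpace.expSeries_div_hasSum_exp (-(1 / 2 * (r ^ 2 * β)))
    rw [← Real.exp_eq_exp_ℝ] at h1
    refine (Complex.hasSum_ofReal.2 h1).congr_fun fun i => ?_
    simp only [Function.comp_apply, gaussCoeff, even_two, Even.mul_right, if_true]
    rw [Nat.mul_div_cancel_left _ (by norm_num), pow_mul]
    push_cast
    rw [← mul_div_assoc, ← mul_pow]
    congr 2
    ring
  · intro q hq
    have : ¬ Even q := fun ⟨i, hi⟩ => hq ⟨i, by simp only; omega⟩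
    simp [gaussCoeff, this]

/-- The Taylor coefficients at `0` of `r ↦ shiftTransform S u (r h)`; they are integrals of `u`
against Hermite polynomials. -/
def hermiteCoeff (S : Matrix (Fin N) (Fin N) ℝ) (u : (Fin N → ℝ) → ℂ) (h : Fin N → ℝ) (n : ℕ) :
    ℂ :=
  ∑ p ∈ Finset.HasAntidiagonal.antidiagonal n,
    gaussCoeff (h ⬝ᵥ S.mulVec h) p.1 * (directionalMoment (gaussian S) u h p.2 / p.2.factorial)

/-- Cauchy product of the Taylor series of the Gaussian factor and of the Laplace transform of `u`
along the ray through `h`; both converge absolutely for every `r`. -/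
theorem hasSum_hermiteCoeff {S : Matrix (Fin N) (Fin N) ℝ} (hS : S.PosDef)
    {u : (Fin N → ℝ) → ℂ} (hu : HasExpMoments (gaussian S) u) (h : Fin N → ℝ) (r : ℝ) :
    HasSum (fun n : ℕ => (r : ℂ) ^ n * hermiteCoeff S u h n) (shiftTransform S u (r • h)) := by
  have h1 := hasSum_gaussCoeff (h ⬝ᵥ S.mulVec h) r
  have h2 := hu.hasSum_directionalMoment h r
  have h3 := summable_norm_sum_mul_antidiagonal_of_summable_norm h1.summable.norm h2.summable.norm
  have h4 := tsum_mul_tsum_eq_tsum_sum_antidiagonal_of_summable_norm h1.summable.norm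
    h2.summable.norm
  rw [h1.tsum_eq, h2.tsum_eq] at h4
  have h5 := h3.of_norm.hasSum
  rw [← h4] at h5
  have h6 : shiftTransform S u (r • h) =
      ((Real.exp (-(1 / 2 * (r ^ 2 * (h ⬝ᵥ S.mulVec h)))) : ℝ) : ℂ) *
        ∫ x, u x * ((Real.exp ((r • h) ⬝ᵥ x) : ℝ) : ℂ) ∂(gaussian S) := by
    rw [shiftTransform_eq hS hu.1, mulVec_smul, smul_dotProduct, dotProduct_smul, smul_eq_mul,
      smul_eq_mul, ← mul_assoc r r, sq]
  rw [h6]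
  refine h5.congr_fun fun n => ?_
  rw [hermiteCoeff, Finset.mul_sum]
  refine Finset.sum_congr rfl fun p hp => ?_
  rw [← Finset.HasAntidiagonal.mem_antidiagonal.1 hp, pow_add]
  ring

/-- Everywhere convergent power series are determined by their sums. -/
theorem powerSeries_coeff_unique {c d : ℕ → ℂ} {f : ℝ → ℂ}
    (hc : ∀ r : ℝ, HasSum (fun n : ℕ => (r : ℂ) ^ n * c n) (f r))
    (hd : ∀ r : ℝ, HasSum (fun n : ℕ => (r : ℂ) ^ n * d n) (f r)) : c = d := by
  let p : (ℕ → ℂ) → FormalMultilinearSeries ℝ ℝ ℂ := fun c n =>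
    ContinuousMultilinearMap.mkPiRing ℝ (Fin n) (c n)
  have hp : ∀ c n, (p c).coeff n = c n := fun c n => by
    simp [p, FormalMultilinearSeries.coeff]
  have key : ∀ c : ℕ → ℂ, (∀ r : ℝ, HasSum (fun n : ℕ => (r : ℂ) ^ n * c n) (f r)) →
      HasFPowerSeriesAt f (p c) 0 := by
    intro c hc
    rw [hasFPowerSeriesAt_iff]
    refine Eventually.of_forall fun z => ?_
    simpa [hp, Complex.real_smul] using hc z
  funext n
  rw [← hp c n, ← hp d n, (key c hc).eq_formalMultilinearSeries (key d hd)]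

/-- The substitution `h ↦ k` is linear, so it maps rays to rays and the two power series in `r` can
be compared term by term. -/
theorem hermiteCoeff_transfer {S R A : Matrix (Fin N) (Fin N) ℝ} (hS : S.PosDef) (hR : R.PosDef)
    (hSR : S = R + A * S * A.transpose) {u : (Fin N → ℝ) → ℂ}
    (hu : HasExpMoments (gaussian S) u) {h k : Fin N → ℝ}
    (hk : S.mulVec k = A.mulVec (S.mulVec h)) :
    hermiteCoeff S (transfer A (gaussian R) u) h = hermiteCoeff S u k := by
  refine powerSeries_coeff_unique (fun r => hasSum_hermiteCoeff hS
    (hasExpMoments_transfer hS hR hSR hu) h r) (fun r => ?_)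
  rw [shiftTransform_transfer hS hR hSR hu (k := r • k)
    (by rw [mulVec_smul, mulVec_smul, mulVec_smul, hk])]
  exact hasSum_hermiteCoeff hS hu k r

theorem hermiteCoeff_const_mul {S : Matrix (Fin N) (Fin N) ℝ} (c : ℂ) (u : (Fin N → ℝ) → ℂ)
    (h : Fin N → ℝ) (n : ℕ) :
    hermiteCoeff S (fun x => c * u x) h n = c * hermiteCoeff S u h n := by
  simp only [hermiteCoeff, directionalMoment, mul_assoc c, integral_const_mul, Finset.mul_sum]
  refine Finset.sum_congr rfl fun p _ => ?_
  ring

theorem hermiteCoeff_sub {S : Matrix (Fin N) (Fin N) ℝ} {u v : (Fin N → ℝ) → ℂ}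
    (hu : HasExpMoments (gaussian S) u) (hv : HasExpMoments (gaussian S) v)
    (h : Fin N → ℝ) (n : ℕ) :
    hermiteCoeff S (fun x => u x - v x) h n = hermiteCoeff S u h n - hermiteCoeff S v h n := by
  rw [hermiteCoeff, hermiteCoeff, hermiteCoeff, ← Finset.sum_sub_distrib]
  refine Finset.sum_congr rfl fun p _ => ?_
  rw [directionalMoment, directionalMoment, directionalMoment, ← mul_sub, ← sub_div,
    ← integral_sub (hu.integrable_mul_pow h _) (hv.integrable_mul_pow h _)]
  simp only [sub_mul]

theorem hermiteCoeff_congr_ae {S : Matrix (Fin N) (Fin N) ℝ} {u v : (Fin N → ℝ) → ℂ}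
    (huv : u =ᵐ[gaussian S] v) : hermiteCoeff S u = hermiteCoeff S v := by
  funext h n
  refine Finset.sum_congr rfl fun p _ => ?_
  congr 2
  refine integral_congr_ae ?_
  filter_upwards [huv] with x hx
  simp only [hx]

theorem memLp_dotProduct_pow_gaussian {S : Matrix (Fin N) (Fin N) ℝ} (hS : S.PosDef)
    (h : Fin N → ℝ) (p : ℕ) :
    MemLp (fun x => (((h ⬝ᵥ x) ^ p : ℝ) : ℂ)) 2 (gaussian S) := by
  have := isProbabilityMeasure_gaussian hS
  have h1 : HasExpMoments (gaussian S) fun _ => 1 :=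
    hasExpMoments_of_memLp hS stronglyMeasurable_const (memLp_const 1)
  refine MemLp.ofReal (f := fun x => (h ⬝ᵥ x) ^ p) ?_
  rw [memLp_two_iff_integrable_sq (continuous_dotProduct_pow h p).aestronglyMeasurable]
  have h2 := (h1.integrable_mul_pow h (p * 2)).re
  refine h2.congr (ae_of_all _ fun x => ?_)
  simp only [one_mul, pow_mul]
  exact Complex.ofReal_re _

/-- The Hermite coefficients are continuous functionals on `L²`. -/
theorem tendsto_hermiteCoeff {S : Matrix (Fin N) (Fin N) ℝ} (hS : S.PosDef) {ι : Type*}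
    {l : Filter ι} {w : ι → (Fin N → ℝ) → ℂ} (hwm : ∀ t, StronglyMeasurable (w t))
    (hw : Tendsto (fun t => eLpNorm (w t) 2 (gaussian S)) l (𝓝 0)) (h : Fin N → ℝ) (n : ℕ) :
    Tendsto (fun t => hermiteCoeff S (w t) h n) l (𝓝 0) := by
  have h1 : ∀ p, Tendsto (fun t => directionalMoment (gaussian S) (w t) h p) l (𝓝 0) := by
    intro p
    have hm := memLp_dotProduct_pow_gaussian hS h p
    rw [tendsto_zero_iff_enorm_tendsto_zero]
    have h2 := ENNReal.Tendsto.mul_const hw (b := eLpNorm (fun x => (((h ⬝ᵥ x) ^ p : ℝ) : ℂ)) 2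
      (gaussian S)) (Or.inr hm.2.ne)
    rw [zero_mul] at h2
    refine tendsto_of_tendsto_of_tendsto_of_le_of_le tendsto_const_nhds h2 (fun t => zero_le)
      (fun t => ?_)
    refine (enorm_integral_le_lintegral_enorm _).trans ?_
    rw [← eLpNorm_one_eq_lintegral_enorm]
    -- Cauchy–Schwarz against a power of a linear form, which is in `L²` of the Gaussian.
    have h3 := eLpNorm_smul_le_mul_eLpNorm (p := 2) (q := 2) (r := 1) hm.1
      (hwm t).aestronglyMeasurable
    exact h3
  unfold hermiteCoeff
  have h2 : Tendsto (fun t => ∑ p ∈ Finset.HasAntidiagonal.antidiagonal n, gaussCoeff (h ⬝ᵥ S.mulVec h) p.1 *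
      (directionalMoment (gaussian S) (w t) h p.2 / p.2.factorial)) l
      (𝓝 (∑ p ∈ Finset.HasAntidiagonal.antidiagonal n, gaussCoeff (h ⬝ᵥ S.mulVec h) p.1 *
        (0 / p.2.factorial))) :=
    tendsto_finsetSum _ fun p _ => ((h1 p.2).div_const _).const_mul _
  simpa using h2

theorem hermiteCoeff_smul {S : Matrix (Fin N) (Fin N) ℝ} (hS : S.PosDef)
    {u : (Fin N → ℝ) → ℂ} (hu : HasExpMoments (gaussian S) u) (h : Fin N → ℝ) (c : ℝ) (n : ℕ) :
    hermiteCoeff S u (c • h) n = (c : ℂ) ^ n * hermiteCoeff S u h n := by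
  have h1 := powerSeries_coeff_unique (f := fun r => shiftTransform S u (r • c • h))
    (d := fun n => (c : ℂ) ^ n * hermiteCoeff S u h n)
    (fun r => hasSum_hermiteCoeff hS hu (c • h) r) (fun r => by
      have h2 := hasSum_hermiteCoeff hS hu h (r * c)
      rw [← smul_smul] at h2
      refine h2.congr_fun fun n => ?_
      push_cast
      ring)
  exact congrFun h1 n

end Hermite

/-! ### Real matrices with one complex eigenvalue. -/

section SingleEigenvalue

open Matrix

theorem isEigenvalue_iff_aeval_charpoly (B : Matrix (Fin N) (Fin N) ℝ) (z : ℂ) :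
    IsEigenvalue B z ↔ Polynomial.aeval z B.charpoly = 0 := by
  have h : (toLin' (B.map Complex.ofReal)).charpoly = B.charpoly.map Complex.ofRealHom := by
    rw [Matrix.charpoly_toLin', ← Matrix.charpoly_map]
    rfl
  rw [IsEigenvalue, Module.End.hasEigenvalue_iff_isRoot_charpoly, h, Polynomial.IsRoot.def,
    Polynomial.eval_map]
  rfl

/-- Eigenvalues of a real matrix are stable under conjugation, so the only one is a real `l`. The
characteristic polynomial is then `(X - l)^N`, and Cayley–Hamilton concludes. -/
theorem exists_nilpotent_of_unique_eigenvalue {B : Matrix (Fin N) (Fin N) ℝ}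
    (hB : ∀ z : ℂ, IsEigenvalue B z → z.re < 0) (hone : ∃! z : ℂ, IsEigenvalue B z) :
    ∃ l : ℝ, l < 0 ∧ (B - l • (1 : Matrix (Fin N) (Fin N) ℝ)) ^ N = 0 := by
  obtain ⟨z, hz, hz1⟩ := hone
  have hzc : (starRingEnd ℂ) z = z := by
    refine hz1 _ ?_
    rw [isEigenvalue_iff_aeval_charpoly] at hz ⊢
    rw [Polynomial.aeval_conj, hz, map_zero]
  obtain ⟨l, rfl⟩ := Complex.conj_eq_iff_real.1 hzc
  refine ⟨l, by simpa using hB _ hz, ?_⟩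
  set p := B.charpoly.map Complex.ofRealHom with hp
  have hroots : p.roots = Multiset.replicate (Multiset.card p.roots) (l : ℂ) := by
    rw [Multiset.eq_replicate]
    refine ⟨rfl, fun w hw => hz1 w ?_⟩
    beta_reduce
    rw [isEigenvalue_iff_aeval_charpoly]
    have h1 := (Polynomial.mem_roots'.1 hw).2
    rwa [Polynomial.IsRoot.def, hp, Polynomial.eval_map] at h1
  have hmonic : p.Monic := (Matrix.charpoly_monic B).map _
  have hsplit : p.Splits := IsAlgClosed.splits p
  have hcard : Multiset.card p.roots = N := by
    rw [← hsplit.natDegree_eq_card_roots, hp, (Matrix.charpoly_monic B).natDegree_map,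
      Matrix.charpoly_natDegree_eq_dim, Fintype.card_fin]
  have hpX : p = (Polynomial.X - Polynomial.C (l : ℂ)) ^ N := by
    rw [hsplit.eq_prod_roots_of_monic hmonic, hroots, hcard]
    simp
  have hreal : B.charpoly = (Polynomial.X - Polynomial.C l) ^ N := by
    apply Polynomial.map_injective Complex.ofRealHom Complex.ofRealHom.injective
    rw [← hp, hpX]
    simp
  have h := Matrix.aeval_self_charpoly B
  rw [hreal] at h
  simpa [Algebra.algebraMap_eq_smul_one] using h

theorem exp_smul_of_nilpotent {B : Matrix (Fin N) (Fin N) ℝ} {l : ℝ} {m : ℕ}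
    (hBl : (B - l • (1 : Matrix (Fin N) (Fin N) ℝ)) ^ m = 0) (t : ℝ) :
    NormedSpace.exp (t • B) = Real.exp (l * t) •
      ∑ i ∈ Finset.range m, (t ^ i / i.factorial) • (B - l • (1 : Matrix (Fin N) (Fin N) ℝ)) ^ i := by
  set M := B - l • (1 : Matrix (Fin N) (Fin N) ℝ) with hM
  have h1 : t • B = Matrix.diagonal (fun _ => l * t) + t • M := by
    rw [hM, smul_sub, smul_smul, mul_comm t l, ← Matrix.smul_one_eq_diagonal]
    abel
  have hcomm : Commute (Matrix.diagonal (fun _ => l * t)) (t • M) := by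
    rw [← Matrix.smul_one_eq_diagonal]
    exact (Commute.one_left _).smul_left _
  have h2 : NormedSpace.exp (t • M) = ∑ i ∈ Finset.range m, (t ^ i / i.factorial) • M ^ i := by
    rw [NormedSpace.exp_eq_tsum ℝ]
    beta_reduce
    rw [tsum_eq_sum (s := Finset.range m)]
    · refine Finset.sum_congr rfl fun i _ => ?_
      rw [smul_pow, smul_smul, div_eq_inv_mul]
    · intro i hi
      rw [smul_pow, pow_eq_zero_of_le (not_lt.1 fun h => hi (Finset.mem_range.2 h)) hBl, smul_zero,
        smul_zero]
  rw [h1, Matrix.exp_add_of_commute _ _ hcomm, Matrix.exp_diagonal, h2]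
  have h3 : Matrix.diagonal (NormedSpace.exp fun _ : Fin N => l * t) =
      Real.exp (l * t) • (1 : Matrix (Fin N) (Fin N) ℝ) := by
    rw [Matrix.smul_one_eq_diagonal, Real.exp_eq_exp_ℝ]
    congr 1
    funext i
    rw [Pi.coe_exp]
  rw [h3, smul_mul_assoc, one_mul]

end SingleEigenvalue

/-! ### Convergence, positivity and stationarity of the covariance matrices. -/

section Covariance

open Matrix

/-- The integrand `e^{sB} Q e^{sB*}` of the covariance matrices. -/
def covIntegrand (Q B : Matrix (Fin N) (Fin N) ℝ) (s : ℝ) : Matrix (Fin N) (Fin N) ℝ :=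
  NormedSpace.exp (s • B) * Q * NormedSpace.exp (s • B.transpose)

variable {Q B : Matrix (Fin N) (Fin N) ℝ} {l : ℝ} {m : ℕ}

theorem exp_smul_transpose (B : Matrix (Fin N) (Fin N) ℝ) (s : ℝ) :
    NormedSpace.exp (s • B.transpose) = (NormedSpace.exp (s • B)).transpose := by
  rw [← Matrix.exp_transpose, transpose_smul]

theorem covIntegrand_apply (s : ℝ) (i j : Fin N) :
    covIntegrand Q B s i j = ∑ b, (∑ a, NormedSpace.exp (s • B) i a * Q a b) *
      NormedSpace.exp (s • B) j b := by
  rw [covIntegrand, exp_smul_transpose, Matrix.mul_apply]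
  simp only [Matrix.mul_apply, transpose_apply]

theorem covIntegrand_add (s t : ℝ) :
    covIntegrand Q B (s + t) = NormedSpace.exp (t • B) * covIntegrand Q B s *
      (NormedSpace.exp (t • B)).transpose := by
  have h : NormedSpace.exp ((s + t) • B) = NormedSpace.exp (t • B) * NormedSpace.exp (s • B) := by
    rw [add_comm, add_smul, Matrix.exp_add_of_commute]
    exact ((Commute.refl B).smul_left _).smul_right _
  simp only [covIntegrand, exp_smul_transpose, h, transpose_mul, Matrix.mul_assoc]

theorem exp_smul_apply_of_nilpotent (hBl : (B - l • (1 : Matrix (Fin N) (Fin N) ℝ)) ^ m = 0)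
    (i j : Fin N) : (fun t : ℝ => NormedSpace.exp (t • B) i j) = fun t => Real.exp (l * t) *
      ∑ k ∈ Finset.range m, (t ^ k / k.factorial) *
        ((B - l • (1 : Matrix (Fin N) (Fin N) ℝ)) ^ k) i j := by
  funext t
  rw [exp_smul_of_nilpotent hBl t]
  simp only [Matrix.smul_apply, Matrix.sum_apply, smul_eq_mul]

theorem continuous_exp_smul_apply (hBl : (B - l • (1 : Matrix (Fin N) (Fin N) ℝ)) ^ m = 0)
    (i j : Fin N) : Continuous fun t : ℝ => NormedSpace.exp (t • B) i j := by
  rw [exp_smul_apply_of_nilpotent hBl]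
  fun_prop

theorem continuous_covIntegrand_apply (hBl : (B - l • (1 : Matrix (Fin N) (Fin N) ℝ)) ^ m = 0)
    (i j : Fin N) : Continuous fun s : ℝ => covIntegrand Q B s i j := by
  simp only [covIntegrand_apply]
  have h := continuous_exp_smul_apply hBl
  exact continuous_finsetSum _ fun b _ => (continuous_finsetSum _ fun a _ =>
    (h i a).mul continuous_const).mul (h j b)

theorem isBigO_exp_smul_apply (hl : l < 0)
    (hBl : (B - l • (1 : Matrix (Fin N) (Fin N) ℝ)) ^ m = 0) (i j : Fin N) :
    (fun t : ℝ => NormedSpace.exp (t • B) i j) =O[atTop] fun t => Real.exp (l / 2 * t) := by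
  rw [exp_smul_apply_of_nilpotent hBl]
  have h1 : (fun t : ℝ => ∑ k ∈ Finset.range m, (t ^ k / k.factorial) *
      ((B - l • (1 : Matrix (Fin N) (Fin N) ℝ)) ^ k) i j) =O[atTop]
      fun t => Real.exp (-(l / 2) * t) := by
    refine Asymptotics.IsBigO.fun_sum fun k _ => ?_
    -- Half of the decay `e^{lt}` is spent on absorbing the polynomial factor.
    have h2 := (isLittleO_pow_exp_pos_mul_atTop k (b := -(l / 2)) (by linarith)).isBigO
    refine (h2.const_mul_left (((B - l • (1 : Matrix (Fin N) (Fin N) ℝ)) ^ k) i j /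
      k.factorial)).congr_left fun t => ?_
    ring
  refine ((Asymptotics.isBigO_refl (fun t : ℝ => Real.exp (l * t)) atTop).mul h1).congr_right
    fun t => ?_
  rw [← Real.exp_add]
  congr 1
  ring

theorem integrableOn_covIntegrand (hl : l < 0)
    (hBl : (B - l • (1 : Matrix (Fin N) (Fin N) ℝ)) ^ m = 0) (i j : Fin N) :
    IntegrableOn (fun s : ℝ => covIntegrand Q B s i j) (Set.Ioi 0) := by
  -- The integrand is quadratic in the entries of `e^{sB}`, each `O(e^{ls/2})`, whence the rate `l`.
  refine integrable_of_isBigO_exp_neg (b := -l) (by linarith)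
    (continuous_covIntegrand_apply hBl i j).continuousOn ?_
  simp only [covIntegrand_apply]
  refine Asymptotics.IsBigO.fun_sum fun b _ => ?_
  have h1 : (fun s : ℝ => ∑ a, NormedSpace.exp (s • B) i a * Q a b) =O[atTop]
      fun t => Real.exp (l / 2 * t) := by
    refine Asymptotics.IsBigO.fun_sum fun a _ => ?_
    refine ((isBigO_exp_smul_apply hl hBl i a).const_mul_left (Q a b)).congr_left fun t => ?_
    ring
  refine (h1.mul (isBigO_exp_smul_apply hl hBl j b)).congr_right fun t => ?_
  rw [← Real.exp_add]
  congr 1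
  ring

/-- The matrix `∫_T e^{sB} Q e^{sB*} ds`. -/
def covOn (Q B : Matrix (Fin N) (Fin N) ℝ) (T : Set ℝ) : Matrix (Fin N) (Fin N) ℝ :=
  Matrix.of fun i j => ∫ s in T, covIntegrand Q B s i j

theorem cov_eq_covOn (Q B : Matrix (Fin N) (Fin N) ℝ) (t : ℝ) :
    cov Q B t = covOn Q B (Set.Ioc 0 t) := rfl

theorem covInf_eq_covOn (Q B : Matrix (Fin N) (Fin N) ℝ) :
    covInf Q B = covOn Q B (Set.Ioi 0) := rfl

theorem posDef_covIntegrand (hQ : Q.PosDef) (s : ℝ) : (covIntegrand Q B s).PosDef := by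
  rw [covIntegrand, exp_smul_transpose, ← conjTranspose_eq_transpose_of_trivial]
  refine hQ.mul_mul_conjTranspose_same ?_
  exact Matrix.vecMul_injective_of_isUnit (Matrix.isUnit_exp _)

theorem dotProduct_covOn_mulVec {T : Set ℝ}
    (hint : ∀ i j, IntegrableOn (fun s : ℝ => covIntegrand Q B s i j) T) (x : Fin N → ℝ) :
    IntegrableOn (fun s => x ⬝ᵥ (covIntegrand Q B s).mulVec x) T ∧
      x ⬝ᵥ (covOn Q B T).mulVec x = ∫ s in T, x ⬝ᵥ (covIntegrand Q B s).mulVec x := by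
  have h1 : ∀ i j, IntegrableOn (fun s => x i * (covIntegrand Q B s i j * x j)) T := fun i j =>
    ((hint i j).mul_const _).const_mul _
  simp only [dotProduct, Matrix.mulVec, Finset.mul_sum]
  refine ⟨integrable_finsetSum _ fun i _ => integrable_finsetSum _ fun j _ => h1 i j, ?_⟩
  rw [integral_finsetSum _ fun i _ => integrable_finsetSum _ fun j _ => h1 i j]
  refine Finset.sum_congr rfl fun i _ => ?_
  rw [integral_finsetSum _ fun j _ => h1 i j]
  refine Finset.sum_congr rfl fun j _ => ?_
  rw [integral_const_mul, integral_mul_const]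
  rfl

theorem posDef_covOn (hQ : Q.PosDef) {T : Set ℝ}
    (hint : ∀ i j, IntegrableOn (fun s : ℝ => covIntegrand Q B s i j) T)
    (hT0 : 0 < volume T) : (covOn Q B T).PosDef := by
  refine PosDef.of_dotProduct_mulVec_pos ?_ fun x hx => ?_
  · ext i j
    simp only [covOn, conjTranspose_apply, of_apply, star_trivial]
    congr 1
    funext s
    simpa using (posDef_covIntegrand (B := B) hQ s).isHermitian.apply i j
  · rw [star_trivial]
    obtain ⟨h1, h2⟩ := dotProduct_covOn_mulVec hint x
    have h3 : ∀ s, 0 < x ⬝ᵥ (covIntegrand Q B s).mulVec x := fun s => by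
      simpa using (posDef_covIntegrand (B := B) hQ s).dotProduct_mulVec_pos hx
    rw [h2, setIntegral_pos_iff_support_of_nonneg_ae (ae_of_all _ fun s => (h3 s).le) h1]
    have : Function.support (fun s => x ⬝ᵥ (covIntegrand Q B s).mulVec x) = Set.univ :=
      Set.eq_univ_of_forall fun s => (h3 s).ne'
    rwa [this, Set.univ_inter]

theorem posDef_covInf (hQ : Q.PosDef) (hl : l < 0)
    (hBl : (B - l • (1 : Matrix (Fin N) (Fin N) ℝ)) ^ m = 0) : (covInf Q B).PosDef := by
  rw [covInf_eq_covOn]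
  exact posDef_covOn hQ (integrableOn_covIntegrand hl hBl) (by simp)

theorem posDef_cov (hQ : Q.PosDef) (hl : l < 0)
    (hBl : (B - l • (1 : Matrix (Fin N) (Fin N) ℝ)) ^ m = 0) {t : ℝ} (ht : 0 < t) :
    (cov Q B t).PosDef := by
  rw [cov_eq_covOn]
  exact posDef_covOn hQ (fun i j => (integrableOn_covIntegrand hl hBl i j).mono_set
    Set.Ioc_subset_Ioi_self) (by simpa using ht)

/-- Split the integral at `t` and translate the tail back to the origin, where `e^{(s+t)B} = e^{tB}
e^{sB}` factors out. This is the invariance of `γ_∞` at the level of covariances. -/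
theorem covInf_eq_cov_add (hl : l < 0)
    (hBl : (B - l • (1 : Matrix (Fin N) (Fin N) ℝ)) ^ m = 0) {t : ℝ} (ht : 0 < t) :
    covInf Q B = cov Q B t + NormedSpace.exp (t • B) * covInf Q B *
      (NormedSpace.exp (t • B)).transpose := by
  have hint := integrableOn_covIntegrand (Q := Q) hl hBl
  ext i j
  rw [covInf_eq_covOn, cov_eq_covOn, Matrix.add_apply]
  simp only [Matrix.mul_apply, covOn, of_apply, transpose_apply, Finset.sum_mul]
  rw [← Set.Ioc_union_Ioi_eq_Ioi ht.le, setIntegral_union Set.Ioc_disjoint_Ioi_same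
    measurableSet_Ioi ((hint i j).mono_set Set.Ioc_subset_Ioi_self)
    ((hint i j).mono_set (Set.Ioi_subset_Ioi ht.le)), Set.Ioc_union_Ioi_eq_Ioi ht.le]
  congr 1
  have h1 := (measurePreserving_add_right volume t).setIntegral_preimage_emb
    (measurableEmbedding_addRight t) (fun s => covIntegrand Q B s i j) (Set.Ioi t)
  have h2 : (fun s : ℝ => s + t) ⁻¹' Set.Ioi t = Set.Ioi 0 := by
    ext s; simp
  rw [h2] at h1
  rw [← h1]
  simp only [covIntegrand_add, Matrix.mul_apply, transpose_apply, Finset.sum_mul]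
  have h3 : ∀ a b : Fin N, IntegrableOn (fun s => NormedSpace.exp (t • B) i b *
      covIntegrand Q B s b a * NormedSpace.exp (t • B) j a) (Set.Ioi 0) := fun a b =>
    ((hint b a).const_mul _).mul_const _
  rw [integral_finsetSum _ fun a _ => integrable_finsetSum _ fun b _ => h3 a b]
  refine Finset.sum_congr rfl fun a _ => ?_
  rw [integral_finsetSum _ fun b _ => h3 a b]
  refine Finset.sum_congr rfl fun b _ => ?_
  rw [integral_mul_const, integral_const_mul]

end Covariance

/-! ### Polynomial dependence of Hermite coefficients on a parameter. -/

section PolynomialFunctions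

open Matrix

/-- A function on the real line given by a complex polynomial. -/
def IsPolynomialFunction (f : ℝ → ℂ) : Prop :=
  ∃ R : Polynomial ℂ, ∀ t : ℝ, f t = R.eval (t : ℂ)

namespace IsPolynomialFunction

theorem const (c : ℂ) : IsPolynomialFunction fun _ => c :=
  ⟨Polynomial.C c, fun t => by simp⟩

theorem ofReal_pow (i : ℕ) : IsPolynomialFunction fun t => (t : ℂ) ^ i :=
  ⟨Polynomial.X ^ i, fun t => by simp⟩

theorem mul {f g : ℝ → ℂ} (hf : IsPolynomialFunction f) (hg : IsPolynomialFunction g) :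
    IsPolynomialFunction fun t => f t * g t := by
  obtain ⟨R, hR⟩ := hf
  obtain ⟨T, hT⟩ := hg
  exact ⟨R * T, fun t => by simp [hR, hT]⟩

theorem pow {f : ℝ → ℂ} (hf : IsPolynomialFunction f) (p : ℕ) :
    IsPolynomialFunction fun t => f t ^ p := by
  obtain ⟨R, hR⟩ := hf
  exact ⟨R ^ p, fun t => by simp [hR]⟩

theorem sum {ι : Type*} (s : Finset ι) {f : ι → ℝ → ℂ} (hf : ∀ i, IsPolynomialFunction (f i)) :
    IsPolynomialFunction fun t => ∑ i ∈ s, f i t := by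
  choose R hR using hf
  exact ⟨∑ i ∈ s, R i, fun t => by simp [hR, Polynomial.eval_finsetSum]⟩

end IsPolynomialFunction

theorem HasExpMoments.mul_dotProduct {μ : Measure (Fin N → ℝ)} {u : (Fin N → ℝ) → ℂ}
    (hu : HasExpMoments μ u) (k : Fin N → ℝ) :
    HasExpMoments μ fun x => u x * ((k ⬝ᵥ x : ℝ) : ℂ) := by
  have hk : Continuous fun x : Fin N → ℝ => k ⬝ᵥ x := by
    unfold dotProduct
    fun_prop
  have hm : StronglyMeasurable fun x => u x * ((k ⬝ᵥ x : ℝ) : ℂ) :=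
    hu.1.mul (Complex.continuous_ofReal.comp hk).stronglyMeasurable
  refine ⟨hm, fun h => ?_⟩
  -- Since `|a| ≤ e^a + e^{-a}`, a linear factor costs only a shift of the exponent by `±k`.
  have hb := ((hu.2 (h + k)).norm.add (hu.2 (h - k)).norm)
  refine hb.mono' (hm.mul (Complex.continuous_ofReal.comp
    (continuous_exp_dotProduct h)).stronglyMeasurable).aestronglyMeasurable
    (ae_of_all _ fun x => ?_)
  simp only [norm_mul, Complex.norm_real, Real.norm_eq_abs, Real.abs_exp, Pi.add_apply,
    add_dotProduct, neg_dotProduct, sub_eq_add_neg, Real.exp_add]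
  have h1 : |k ⬝ᵥ x| ≤ Real.exp (k ⬝ᵥ x) + Real.exp (-(k ⬝ᵥ x)) := by
    have h2 := Real.add_one_le_exp (k ⬝ᵥ x)
    have h3 := Real.add_one_le_exp (-(k ⬝ᵥ x))
    have h4 := Real.exp_pos (k ⬝ᵥ x)
    have h5 := Real.exp_pos (-(k ⬝ᵥ x))
    rw [abs_le]
    constructor <;> linarith
  calc ‖u x‖ * |k ⬝ᵥ x| * Real.exp (h ⬝ᵥ x)
      ≤ ‖u x‖ * (Real.exp (k ⬝ᵥ x) + Real.exp (-(k ⬝ᵥ x))) * Real.exp (h ⬝ᵥ x) := by gcongr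
    _ = _ := by ring

/-- Induction on `p` with `u` arbitrary: expanding one factor of the power over the curve absorbs
`⟨g i, x⟩` into `u`, leaving a moment of order `p`. -/
theorem isPolynomialFunction_directionalMoment {μ : Measure (Fin N → ℝ)} (m p : ℕ)
    (g : ℕ → Fin N → ℝ) {u : (Fin N → ℝ) → ℂ} (hu : HasExpMoments μ u) :
    IsPolynomialFunction fun t =>
      directionalMoment μ u (∑ i ∈ Finset.range m, t ^ i • g i) p := by
  induction p generalizing u with
  | zero =>
    simp only [directionalMoment, pow_zero]
    exact .const _
  | succ p ih =>
    have h1 : ∀ t : ℝ, directionalMoment μ u (∑ i ∈ Finset.range m, t ^ i • g i) (p + 1) =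
        ∑ i ∈ Finset.range m, (t : ℂ) ^ i * directionalMoment μ
          (fun x => u x * ((g i ⬝ᵥ x : ℝ) : ℂ)) (∑ i ∈ Finset.range m, t ^ i • g i) p := by
      intro t
      simp only [directionalMoment, ← integral_const_mul]
      rw [← integral_finsetSum _ fun i _ =>
        ((hu.mul_dotProduct (g i)).integrable_mul_pow _ p).const_mul _]
      refine integral_congr_ae (ae_of_all _ fun x => ?_)
      beta_reduce
      rw [pow_succ]
      nth_rewrite 2 [sum_dotProduct]
      simp only [smul_dotProduct, smul_eq_mul]
      push_cast
      rw [Finset.mul_sum, Finset.mul_sum]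
      refine Finset.sum_congr rfl fun i _ => ?_
      ring
    simp only [h1]
    exact .sum _ fun i => (IsPolynomialFunction.ofReal_pow i).mul (ih (hu.mul_dotProduct (g i)))

theorem isPolynomialFunction_hermiteCoeff {S : Matrix (Fin N) (Fin N) ℝ} (m n : ℕ)
    (g : ℕ → Fin N → ℝ) {u : (Fin N → ℝ) → ℂ} (hu : HasExpMoments (gaussian S) u) :
    IsPolynomialFunction fun t =>
      hermiteCoeff S u (∑ i ∈ Finset.range m, t ^ i • g i) n := by
  have hβ : IsPolynomialFunction fun t => ((-(((∑ i ∈ Finset.range m, t ^ i • g i) ⬝ᵥ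
      S.mulVec (∑ i ∈ Finset.range m, t ^ i • g i)) / 2) : ℝ) : ℂ) := by
    have h1 : ∀ t : ℝ, ((-(((∑ i ∈ Finset.range m, t ^ i • g i) ⬝ᵥ
        S.mulVec (∑ i ∈ Finset.range m, t ^ i • g i)) / 2) : ℝ) : ℂ) =
        ∑ i ∈ Finset.range m, ∑ j ∈ Finset.range m,
          ((t : ℂ) ^ i * (t : ℂ) ^ j) * ((-(g j ⬝ᵥ S.mulVec (g i) / 2) : ℝ) : ℂ) := by
      intro t
      simp only [mulVec_sum, sum_dotProduct, dotProduct_sum, mulVec_smul, smul_dotProduct,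
        dotProduct_smul, smul_eq_mul, Finset.mul_sum, Finset.sum_div, ← Finset.sum_neg_distrib]
      push_cast
      refine Finset.sum_congr rfl fun i _ => Finset.sum_congr rfl fun j _ => ?_
      ring
    simp only [h1]
    exact .sum _ fun i => .sum _ fun j =>
      ((IsPolynomialFunction.ofReal_pow i).mul (.ofReal_pow j)).mul (.const _)
  unfold hermiteCoeff
  refine .sum _ fun p => .mul ?_ ?_
  · unfold gaussCoeff
    split_ifs
    · simp only [div_eq_mul_inv _ (Nat.cast (Nat.factorial _) : ℂ)]
      exact (hβ.pow _).mul (.const _)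
    · exact .const 0
  · simp only [div_eq_mul_inv]
    exact (isPolynomialFunction_directionalMoment m p.2 g hu).mul (.const _)

end PolynomialFunctions

/-! ### Differentiating exponential polynomials. -/

section ExponentialPolynomials

/-- The operator `R ↦ R' + c R`, `c ≠ 0`, is injective on polynomials. -/
theorem eq_zero_of_derivative_add_C_mul {R : Polynomial ℂ} {c : ℂ} (hc : c ≠ 0)
    (h : ∀ t : ℝ, (Polynomial.derivative R + Polynomial.C c * R).eval (t : ℂ) = 0) : R = 0 := by
  have h0 : Polynomial.derivative R + Polynomial.C c * R = 0 := by
    refine Polynomial.eq_zero_of_infinite_isRoot _ ?_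
    refine (Set.infinite_range_of_injective Complex.ofReal_injective).mono ?_
    rintro _ ⟨t, rfl⟩
    exact h t
  -- In top degree the derivative contributes nothing, so `c` times the leading coefficient
  -- vanishes.
  have h1 := congrArg (fun P => Polynomial.coeff P R.natDegree) h0
  simp only [Polynomial.coeff_add, Polynomial.coeff_derivative, Polynomial.coeff_C_mul,
    Polynomial.coeff_eq_zero_of_natDegree_lt (Nat.lt_succ_self _), zero_mul, zero_add,
    Polynomial.coeff_zero, Polynomial.coeff_natDegree, mul_eq_zero, hc, false_or,
    Polynomial.leadingCoeff_eq_zero] at h1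
  exact h1

theorem hasDerivAt_exp_mul_eval (a : ℂ) (R : Polynomial ℂ) (t : ℝ) :
    HasDerivAt (fun t : ℝ => Complex.exp (a * t) * R.eval (t : ℂ))
      (Complex.exp (a * t) * (Polynomial.derivative R + Polynomial.C a * R).eval (t : ℂ)) t := by
  have h1 : HasDerivAt (fun z : ℂ => Complex.exp (a * z) * R.eval z)
      (Complex.exp (a * t) * (a * 1) * R.eval (t : ℂ) +
        Complex.exp (a * t) * (Polynomial.derivative R).eval (t : ℂ)) (t : ℂ) :=
    (((hasDerivAt_id (t : ℂ)).const_mul a).cexp).mul (R.hasDerivAt _)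
  convert h1.comp_ofReal using 1
  simp only [Polynomial.eval_add, Polynomial.eval_mul, Polynomial.eval_C]
  ring

end ExponentialPolynomials

/-! ### Hermite coefficients along the dual flow and the eigenvalue equation. -/

section Flow

open Matrix

variable {Q B : Matrix (Fin N) (Fin N) ℝ} {l : ℝ} {m : ℕ}

/-- The flow `h ↦ Q_∞⁻¹ e^{tB} Q_∞ h`. -/
def dualFlow (Q B : Matrix (Fin N) (Fin N) ℝ) (h : Fin N → ℝ) (t : ℝ) : Fin N → ℝ :=
  (covInf Q B)⁻¹.mulVec ((NormedSpace.exp (t • B)).mulVec ((covInf Q B).mulVec h))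

theorem covInf_mulVec_dualFlow (hS : (covInf Q B).PosDef) (h : Fin N → ℝ) (t : ℝ) :
    (covInf Q B).mulVec (dualFlow Q B h t) =
      (NormedSpace.exp (t • B)).mulVec ((covInf Q B).mulVec h) := by
  rw [dualFlow, mulVec_mulVec,
    mul_nonsing_inv _ ((Matrix.isUnit_iff_isUnit_det _).1 hS.isUnit), one_mulVec]

theorem dualFlow_zero (hS : (covInf Q B).PosDef) (h : Fin N → ℝ) : dualFlow Q B h 0 = h := by
  rw [dualFlow, zero_smul, NormedSpace.exp_zero, one_mulVec, mulVec_mulVec,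
    nonsing_inv_mul _ ((Matrix.isUnit_iff_isUnit_det _).1 hS.isUnit), one_mulVec]

theorem dualFlow_add (hS : (covInf Q B).PosDef) (h : Fin N → ℝ) (s t : ℝ) :
    dualFlow Q B (dualFlow Q B h s) t = dualFlow Q B h (s + t) := by
  rw [dualFlow, covInf_mulVec_dualFlow hS, dualFlow, mulVec_mulVec _ (NormedSpace.exp (t • B)),
    ← Matrix.exp_add_of_commute _ _ (((Commute.refl B).smul_left _).smul_right _), ← add_smul,
    add_comm t s]

theorem dualFlow_eq_sum (hBl : (B - l • (1 : Matrix (Fin N) (Fin N) ℝ)) ^ m = 0)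
    (h : Fin N → ℝ) (t : ℝ) :
    dualFlow Q B h t = Real.exp (l * t) • ∑ i ∈ Finset.range m, t ^ i •
      ((i.factorial : ℝ)⁻¹ • (covInf Q B)⁻¹.mulVec
        (((B - l • (1 : Matrix (Fin N) (Fin N) ℝ)) ^ i).mulVec ((covInf Q B).mulVec h))) := by
  rw [dualFlow, exp_smul_of_nilpotent hBl]
  simp only [smul_mulVec, mulVec_smul, sum_mulVec, mulVec_sum, smul_smul, div_eq_mul_inv]

/-- The flow is `e^{lt}` times a polynomial curve, and homogeneity of degree `n` turns the scalar
into `e^{nlt}`. This is where the single eigenvalue matters: one degree has one exponential rate. -/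
theorem exists_hermiteCoeff_dualFlow (hS : (covInf Q B).PosDef)
    (hBl : (B - l • (1 : Matrix (Fin N) (Fin N) ℝ)) ^ m = 0) {u : (Fin N → ℝ) → ℂ}
    (hu : HasExpMoments (gaussian (covInf Q B)) u) (h : Fin N → ℝ) (n : ℕ) :
    ∃ R : Polynomial ℂ, ∀ t : ℝ, hermiteCoeff (covInf Q B) u (dualFlow Q B h t) n =
      Complex.exp ((n * l : ℂ) * t) * R.eval (t : ℂ) := by
  obtain ⟨R, hR⟩ := isPolynomialFunction_hermiteCoeff m n (fun i => (i.factorial : ℝ)⁻¹ •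
    (covInf Q B)⁻¹.mulVec (((B - l • (1 : Matrix (Fin N) (Fin N) ℝ)) ^ i).mulVec
      ((covInf Q B).mulVec h))) hu
  beta_reduce at hR
  refine ⟨R, fun t => ?_⟩
  rw [dualFlow_eq_sum hBl, hermiteCoeff_smul hS hu, hR, Complex.ofReal_exp, ← Complex.exp_nat_mul]
  push_cast
  rw [mul_assoc]

theorem semigroup_eq_transfer (Q B : Matrix (Fin N) (Fin N) ℝ) (t : ℝ) (u : (Fin N → ℝ) → ℂ) :
    semigroup Q B t u = transfer (NormedSpace.exp (t • B)) (gaussian (cov Q B t)) u := rfl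

theorem hasExpMoments_lp (hS : (covInf Q B).PosDef) (u : Lp ℂ 2 (gammaInf Q B)) :
    HasExpMoments (gaussian (covInf Q B)) u :=
  hasExpMoments_of_memLp hS (Lp.stronglyMeasurable u) (Lp.memLp u)

/-- If `v = L u` then the right derivative at `0` of the Hermite coefficients of `u` along the
dual flow are the Hermite coefficients of `v`. -/
theorem IsGenerator.hasDerivWithinAt_zero (hQ : Q.PosDef) (hl : l < 0)
    (hBl : (B - l • (1 : Matrix (Fin N) (Fin N) ℝ)) ^ m = 0) {u v : Lp ℂ 2 (gammaInf Q B)}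
    (huv : IsGenerator Q B u v) (h : Fin N → ℝ) (n : ℕ) :
    HasDerivWithinAt (fun t => hermiteCoeff (covInf Q B) u (dualFlow Q B h t) n)
      (hermiteCoeff (covInf Q B) v h n) (Set.Ioi 0) 0 := by
  have hS := posDef_covInf hQ hl hBl
  have hu := hasExpMoments_lp hS u
  have hv := hasExpMoments_lp hS v
  have hmeas : ∀ t : ℝ, StronglyMeasurable
      fun x => (t : ℂ)⁻¹ * (semigroup Q B t u x - u x) - v x := by
    intro t
    have : SFinite (gaussian (cov Q B t)) := by unfold gaussian; infer_instance
    exact (((stronglyMeasurable_transfer _ _ hu.1).sub hu.1).const_mul _).sub hv.1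
  have h1 := tendsto_hermiteCoeff hS hmeas huv h n
  rw [hasDerivWithinAt_iff_tendsto_slope' (by simp)]
  have h2 := h1.add_const (hermiteCoeff (covInf Q B) v h n)
  rw [zero_add] at h2
  refine h2.congr' ?_
  filter_upwards [self_mem_nhdsWithin] with t ht
  have hR := posDef_cov hQ hl hBl ht
  have hSR := covInf_eq_cov_add (Q := Q) hl hBl ht
  have hT : HasExpMoments (gaussian (covInf Q B)) (semigroup Q B t u) :=
    hasExpMoments_transfer hS hR hSR hu
  rw [hermiteCoeff_sub ((hT.sub hu).const_mul _) hv, hermiteCoeff_const_mul,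
    hermiteCoeff_sub hT hu, semigroup_eq_transfer,
    hermiteCoeff_transfer hS hR hSR hu (covInf_mulVec_dualFlow hS h t), slope_def_module,
    dualFlow_zero hS, sub_zero, sub_add_cancel, Complex.real_smul, Complex.ofReal_inv]

/-- The group law of the flow moves the base point `s` to `0`. -/
theorem IsGenerator.hasDerivWithinAt (hQ : Q.PosDef) (hl : l < 0)
    (hBl : (B - l • (1 : Matrix (Fin N) (Fin N) ℝ)) ^ m = 0) {u v : Lp ℂ 2 (gammaInf Q B)}
    (huv : IsGenerator Q B u v) (h : Fin N → ℝ) (n : ℕ) (s : ℝ) :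
    HasDerivWithinAt (fun t => hermiteCoeff (covInf Q B) u (dualFlow Q B h t) n)
      (hermiteCoeff (covInf Q B) v (dualFlow Q B h s) n) (Set.Ioi s) s := by
  have hS := posDef_covInf hQ hl hBl
  have h1 := huv.hasDerivWithinAt_zero hQ hl hBl (dualFlow Q B h s) n
  simp only [dualFlow_add hS] at h1
  rw [hasDerivWithinAt_iff_tendsto_slope' (by simp)] at h1 ⊢
  have h2 : Tendsto (fun t : ℝ => t - s) (𝓝[>] s) (𝓝[>] 0) := by
    refine tendsto_nhdsWithin_iff.2 ⟨?_, ?_⟩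
    · have h3 : Tendsto (fun t : ℝ => t - s) (𝓝 s) (𝓝 (s - s)) :=
        (continuous_id.sub continuous_const).tendsto s
      rw [sub_self] at h3
      exact h3.mono_left nhdsWithin_le_nhds
    · filter_upwards [self_mem_nhdsWithin] with t ht
      exact Set.mem_Ioi.2 (sub_pos.2 (Set.mem_Ioi.1 ht))
  refine (h1.comp h2).congr fun t => ?_
  simp only [Function.comp_apply, slope_def_module, add_sub_cancel, sub_zero, add_zero]

/-- By induction the degree-`n` coefficients of `L u - μ u` vanish, so those of `u` satisfy `f' = μ
f` along the flow. An exponential polynomial of rate `n l ≠ μ` can do this only if it is zero. -/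
theorem hermiteCoeff_eq_zero_of_isKilledByPow (hQ : Q.PosDef) (hl : l < 0)
    (hBl : (B - l • (1 : Matrix (Fin N) (Fin N) ℝ)) ^ m = 0) {μ : ℂ} {n : ℕ}
    (hn : (n * l : ℂ) ≠ μ) (k : ℕ) {u : Lp ℂ 2 (gammaInf Q B)} (hu : IsKilledByPow Q B μ k u)
    (h : Fin N → ℝ) : hermiteCoeff (covInf Q B) u h n = 0 := by
  have hS := posDef_covInf hQ hl hBl
  induction k generalizing u h with
  | zero =>
    have hu0 : u = 0 := hu
    have h1 : (u : (Fin N → ℝ) → ℂ) =ᵐ[gaussian (covInf Q B)] fun x => 0 * (0 : ℂ) := by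
      rw [hu0]
      filter_upwards [Lp.coeFn_zero ℂ 2 (gammaInf Q B)] with x hx
      simpa using hx
    rw [hermiteCoeff_congr_ae h1, hermiteCoeff_const_mul, zero_mul]
  | succ k ih =>
    obtain ⟨v, huv, hk⟩ := hu
    obtain ⟨R, hR⟩ := exists_hermiteCoeff_dualFlow hS hBl (hasExpMoments_lp hS u) h n
    have hv : ∀ t : ℝ, hermiteCoeff (covInf Q B) v (dualFlow Q B h t) n =
        μ * hermiteCoeff (covInf Q B) u (dualFlow Q B h t) n := by
      intro t
      have h1 : ((v - μ • u : Lp ℂ 2 (gammaInf Q B)) : (Fin N → ℝ) → ℂ)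
          =ᵐ[gaussian (covInf Q B)] fun x => v x - μ * u x := by
        filter_upwards [Lp.coeFn_sub v (μ • u), Lp.coeFn_smul μ u] with x hx1 hx2
        rw [hx1, Pi.sub_apply, hx2, Pi.smul_apply, smul_eq_mul]
      have h2 := ih hk (dualFlow Q B h t)
      rw [hermiteCoeff_congr_ae h1, hermiteCoeff_sub (hasExpMoments_lp hS v)
        ((hasExpMoments_lp hS u).const_mul μ), hermiteCoeff_const_mul] at h2
      exact sub_eq_zero.1 h2
    have hR0 : R = 0 := by
      refine eq_zero_of_derivative_add_C_mul (sub_ne_zero.2 hn) fun t => ?_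
      have h1 := huv.hasDerivWithinAt hQ hl hBl h n t
      simp only [hv, hR] at h1
      have h2 := (hasDerivAt_exp_mul_eval (n * l : ℂ) R t).hasDerivWithinAt (s := Set.Ioi t)
      -- The generator supplies only a right derivative, which is enough because the explicit
      -- exponential polynomial is differentiable.
      have h3 := (uniqueDiffWithinAt_Ioi t).eq_deriv _ h1 h2
      rw [mul_left_comm] at h3
      have h4 := mul_left_cancel₀ (Complex.exp_ne_zero _) h3
      simp only [Polynomial.eval_add, Polynomial.eval_mul, Polynomial.eval_C] at h4 ⊢
      rw [sub_mul, ← add_sub_assoc, ← h4, sub_self]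
    have h5 := hR 0
    rwa [dualFlow_zero hS, hR0, Polynomial.eval_zero, mul_zero] at h5

end Flow

/-! ### Generalized eigenfunctions and the Mehler operator. -/

section Orthogonality

open Matrix

variable {Q B : Matrix (Fin N) (Fin N) ℝ} {l : ℝ} {m : ℕ}

theorem eq_mehler_stationary (S : Matrix (Fin N) (Fin N) ℝ) :
    S = (3 / 4 : ℝ) • S + ((1 / 2 : ℝ) • (1 : Matrix (Fin N) (Fin N) ℝ)) * S *
      ((1 / 2 : ℝ) • (1 : Matrix (Fin N) (Fin N) ℝ)).transpose := by
  rw [transpose_smul, transpose_one, smul_mul_assoc, one_mul, smul_mul_assoc, mul_smul_comm,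
    mul_one, smul_smul, ← add_smul]
  norm_num

/-- A generalized eigenfunction of `L` is an eigenfunction of the Mehler operator. -/
theorem IsGeneralizedEigenfunction.exists_mehler_eq (hQ : Q.PosDef) (hl : l < 0)
    (hBl : (B - l • (1 : Matrix (Fin N) (Fin N) ℝ)) ^ m = 0) {μ : ℂ}
    {u : Lp ℂ 2 (gammaInf Q B)} (hu : IsGeneralizedEigenfunction Q B μ u) :
    ∃ n : ℕ, (n * l : ℂ) = μ ∧
      transfer ((1 / 2 : ℝ) • 1) (gaussian ((3 / 4 : ℝ) • covInf Q B)) u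
        =ᵐ[gaussian (covInf Q B)] fun x => (1 / 2 : ℂ) ^ n * u x := by
  have hS := posDef_covInf hQ hl hBl
  have hR : ((3 / 4 : ℝ) • covInf Q B).PosDef := hS.smul (by norm_num)
  have hue := hasExpMoments_lp hS u
  obtain ⟨hu0, k, _, hk⟩ := hu
  have hz : ∀ n : ℕ, (n * l : ℂ) ≠ μ → ∀ h, hermiteCoeff (covInf Q B) u h n = 0 := fun n hn h =>
    hermiteCoeff_eq_zero_of_isKilledByPow hQ hl hBl hn k hk h
  -- Otherwise all Hermite coefficients of `u` vanish, hence its transform, hence `u`.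
  have hexists : ∃ n : ℕ, (n * l : ℂ) = μ := by
    by_contra! hne
    apply hu0
    have h0 : HasExpMoments (gaussian (covInf Q B)) fun _ => 0 :=
      ⟨stronglyMeasurable_const, fun h => by simp⟩
    have h1 := ae_eq_of_shiftTransform_eq hS hue h0 fun h => by
      have h2 := hasSum_hermiteCoeff hS hue h 1
      simp only [hz _ (hne _), mul_zero, one_smul] at h2
      rw [h2.unique hasSum_zero]
      simp [shiftTransform]
    apply Lp.ext
    filter_upwards [h1, Lp.coeFn_zero ℂ 2 (gammaInf Q B)] with x hx1 hx2
    rw [hx1, hx2, Pi.zero_apply]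
  obtain ⟨n, hn⟩ := hexists
  refine ⟨n, hn, ?_⟩
  -- Since `l ≠ 0`, no other degree `j` has `j l = μ`; the transform is homogeneous of degree `n`.
  -- The Mehler operator replaces `h` by `h / 2`, hence the factor `2^{-n}`.
  have hhom : ∀ (r : ℝ) (h : Fin N → ℝ), shiftTransform (covInf Q B) u (r • h) =
      (r : ℂ) ^ n * hermiteCoeff (covInf Q B) u h n := by
    intro r h
    refine (hasSum_hermiteCoeff hS hue h r).unique (hasSum_single n fun j hj => ?_)
    rw [hz j, mul_zero]
    rw [← hn]
    intro hjn
    have hl' : (l : ℂ) ≠ 0 := by exact_mod_cast hl.ne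
    exact hj (by exact_mod_cast mul_right_cancel₀ hl' hjn)
  refine ae_eq_of_shiftTransform_eq hS (hasExpMoments_transfer hS hR (eq_mehler_stationary _) hue)
    (hue.const_mul _) fun h => ?_
  rw [shiftTransform_transfer hS hR (eq_mehler_stationary _) hue (h := h) (k := (1 / 2 : ℝ) • h)
    (by rw [mulVec_smul, smul_mulVec, one_mulVec]), hhom]
  have h1 := hhom 1 h
  rw [one_smul, Complex.ofReal_one, one_pow, one_mul] at h1
  rw [← h1]
  simp only [shiftTransform, integral_const_mul]
  push_cast
  rfl

end Orthogonality

end OrnsteinUhlenbeck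

end

theorem mainTheorem1 (N : ℕ) (Q B : Matrix (Fin N) (Fin N) ℝ)
    (hQ : Q.PosDef)
    (hB : ∀ z : ℂ, OrnsteinUhlenbeck.IsEigenvalue B z → z.re < 0)
    (hone : ∃! z : ℂ, OrnsteinUhlenbeck.IsEigenvalue B z)
    (μ₁ μ₂ : ℂ) (hμ : μ₁ ≠ μ₂)
    (u₁ u₂ : Lp ℂ 2 (OrnsteinUhlenbeck.gammaInf Q B))
    (hu₁ : OrnsteinUhlenbeck.IsGeneralizedEigenfunction Q B μ₁ u₁)
    (hu₂ : OrnsteinUhlenbeck.IsGeneralizedEigenfunction Q B μ₂ u₂) :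
    inner ℂ u₁ u₂ = 0 := by
  open OrnsteinUhlenbeck in
  obtain ⟨l, hl, hBl⟩ := exists_nilpotent_of_unique_eigenvalue hB hone
  have hS := posDef_covInf hQ hl hBl
  have hR : ((3 / 4 : ℝ) • covInf Q B).PosDef := hS.smul (by norm_num)
  obtain ⟨n₁, hn₁, hT₁⟩ := hu₁.exists_mehler_eq hQ hl hBl
  obtain ⟨n₂, hn₂, hT₂⟩ := hu₂.exists_mehler_eq hQ hl hBl
  have hn : n₁ ≠ n₂ := by
    rintro rfl
    exact hμ (hn₁.symm.trans hn₂)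
  -- The Mehler operator and its eigenvalue are real, so conjugation preserves the eigenfunction
  -- equation. This lets the bilinear symmetry `integral_mehler_mul` serve the Hermitian inner
  -- product.
  have hconj : transfer ((1 / 2 : ℝ) • 1) (gaussian ((3 / 4 : ℝ) • covInf Q B))
      (fun x => (starRingEnd ℂ) (u₁ x)) =ᵐ[gaussian (covInf Q B)]
      fun x => (1 / 2 : ℂ) ^ n₁ * (starRingEnd ℂ) (u₁ x) := by
    filter_upwards [hT₁] with x hx
    have h1 := congrArg (starRingEnd ℂ) hx
    rw [map_mul, transfer, ← integral_conj] at h1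
    rw [transfer, h1, map_pow, map_div₀, map_one, map_ofNat]
  have hsymm := integral_mehler_mul hS hR (eq_mehler_stationary _)
    (Complex.continuous_conj.comp_stronglyMeasurable (Lp.stronglyMeasurable u₁))
    (Lp.stronglyMeasurable u₂) (Lp.memLp u₁).star (Lp.memLp u₂)
  have hleft : ∫ x, transfer ((1 / 2 : ℝ) • 1) (gaussian ((3 / 4 : ℝ) • covInf Q B))
      (fun x => (starRingEnd ℂ) (u₁ x)) x * u₂ x ∂(gaussian (covInf Q B)) =
      (1 / 2 : ℂ) ^ n₁ * ∫ x, (starRingEnd ℂ) (u₁ x) * u₂ x ∂(gaussian (covInf Q B)) := by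
    rw [← integral_const_mul]
    refine integral_congr_ae ?_
    filter_upwards [hconj] with x hx
    rw [hx, mul_assoc]
  have hright : ∫ x, (starRingEnd ℂ) (u₁ x) * transfer ((1 / 2 : ℝ) • 1)
      (gaussian ((3 / 4 : ℝ) • covInf Q B)) u₂ x ∂(gaussian (covInf Q B)) =
      (1 / 2 : ℂ) ^ n₂ * ∫ x, (starRingEnd ℂ) (u₁ x) * u₂ x ∂(gaussian (covInf Q B)) := by
    rw [← integral_const_mul]
    refine integral_congr_ae ?_
    filter_upwards [hT₂] with x hx
    rw [hx]
    ring
  have hinner : inner ℂ u₁ u₂ =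
      ∫ x, (starRingEnd ℂ) (u₁ x) * u₂ x ∂(gaussian (covInf Q B)) := by
    rw [L2.inner_def]
    refine integral_congr_ae (ae_of_all _ fun x => ?_)
    simp only [RCLike.inner_apply]
    rw [mul_comm]
  rw [hinner]
  have heq := hleft.symm.trans (hsymm.trans hright)
  have hne : (1 / 2 : ℂ) ^ n₁ ≠ (1 / 2 : ℂ) ^ n₂ := by
    intro h
    have h1 : (1 / 2 : ℝ) ^ n₁ = (1 / 2 : ℝ) ^ n₂ := by
      apply Complex.ofReal_injective
      push_cast
      exact h
    exact hn (pow_right_injective₀ (by norm_num) (by norm_num) h1)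
  rcases mul_eq_mul_right_iff.1 heq with h | h
  · exact absurd h hne
  · exact h
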